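/- Let $K$ be a finite subset of the closed unit disc of $\mathbb C$, let $\mathbb N=\{1,2,\dots\}$, and give $K^{\mathbb N}$ the product topology and the shift $(Sx)_n=x_{n+1}$. For $x,y\in K^{\mathbb N}$ and $n\ge 1$ put $$\mathrm{corr}_n(x,y)=\frac1n\sum_{i=1}^n x_i\overline{y_i}-\Bigl(\frac1n\sum_{i=1}^n x_i\Bigr)\Bigl(\frac1n\sum_{i=1}^n\overline{y_i}\Bigr).$$ Call $x,y$ weakly correlated if $\limsup_n|\mathrm{corr}_n(x,y)|>0$, and strongly correlated if $\liminf_n|\mathrm{corr}_n(x,y)|>0$. A continuous map $T:X\to X$ of a compact metric space is strictly ergodic if it is minimal (every forward orbit is dense) and has exactly one invariant Borel probability measure. A point $y\in K^{\mathbb N}$ is strictly ergodic if there are a strictly ergodic $(X,T)$, a continuous $f:X\to\mathbb C$ and $a\in X$ with $y_n=f(T^na)$ for all $n\ge1$. A point $y\in K^{\mathbb N}$ is generic for a shift-invariant Borel probability measure $\nu$ on $K^{\mathbb N}$ if $\lim_n\frac1n\sum_{i=1}^n f(S^iy)=\int f\,d\nu$ for every continuous $f:K^{\mathbb N}\to\mathbb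 C$. **Theorem.** Let $x\in K^{\mathbb N}$. 1. $x$ is weakly correlated to some strictly ergodic point of $K^{\mathbb N}$ if and only if $x$ is weakly correlated to some point of $K^{\mathbb N}$ that is generic for an ergodic shift-invariant Borel probability measure on $K^{\mathbb N}$. 2. $x$ is strongly correlated to some strictly ergodic point of $K^{\mathbb N}$ if and only if $x$ is strongly correlated to some point of $K^{\mathbb N}$ that is generic for an ergodic shift-invariant Borel probability measure on $K^{\mathbb N}$. -/

import Mathlib

open Filter MeasureTheory Topology

namespace SeqCorr

noncomputable section

/-- The correlation of the initial blocks of length `n` of two complex sequences. Sequences are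
indexed by `ℕ`, the entry with index `i` being the `(i+1)`-st term `x_{i+1}`. -/
def corr (x y : ℕ → ℂ) (n : ℕ) : ℂ :=
  (1 / (n : ℂ)) * ∑ i ∈ Finset.range n, x i * (starRingEnd ℂ) (y i)
    - ((1 / (n : ℂ)) * ∑ i ∈ Finset.range n, x i)
      * ((1 / (n : ℂ)) * ∑ i ∈ Finset.range n, (starRingEnd ℂ) (y i))

/-- Weak correlation (of bounded sequences): the limit superior is positive. -/
def WeaklyCorrelated (x y : ℕ → ℂ) : Prop :=
  0 < limsup (fun n => ‖corr x y n‖) atTop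

/-- Strong correlation (of bounded sequences): the limit inferior is positive. -/
def StronglyCorrelated (x y : ℕ → ℂ) : Prop :=
  0 < liminf (fun n => ‖corr x y n‖) atTop

/-- Minimality of a dynamical system: every forward orbit is dense. -/
def IsMinimal {X : Type*} [TopologicalSpace X] (T : X → X) : Prop :=
  ∀ x : X, Dense (Set.range fun n : ℕ => T^[n] x)

/-- Unique ergodicity: there is exactly one invariant probability measure. -/
def IsUniquelyErgodic {X : Type*} [MeasurableSpace X] (T : X → X) : Prop :=
  ∃! μ : Measure X, IsProbabilityMeasure μ ∧ MeasurePreserving T μ μ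

/-- Strict ergodicity of a dynamical system: minimality and unique ergodicity. -/
def IsStrictlyErgodic {X : Type*} [TopologicalSpace X] [MeasurableSpace X] (T : X → X) : Prop :=
  IsMinimal T ∧ IsUniquelyErgodic T

/-- A complex sequence is strictly ergodic if it has the form `x_n = f (T^n a)`, `n ≥ 1`, with `f` a
continuous function on a strictly ergodic system `(X, T)`, where `X` is compact metric and
`T` is continuous. (A compact metric space has at most continuum many points, so that `X : Type`
is no restriction.) -/
def IsStrictlyErgodicSeq (x : ℕ → ℂ) : Prop :=
  ∃ (X : Type) (_ : MetricSpace X) (_ : CompactSpace X) (_ : MeasurableSpace X) (_ : BorelSpace X)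
    (T : X → X) (f : X → ℂ) (a : X),
    Continuous T ∧ IsStrictlyErgodic T ∧ Continuous f ∧ ∀ n : ℕ, x n = f (T^[n + 1] a)

/-- The point `x` is generic for the (invariant probability) measure `μ`: the ergodic averages
`(1/n) ∑_{i=1}^n f (T^i x)` of every continuous function converge to its integral. -/
def IsGeneric {X : Type*} [TopologicalSpace X] [MeasurableSpace X]
    (T : X → X) (μ : Measure X) (x : X) : Prop :=
  ∀ f : X → ℂ, Continuous f →
    Tendsto (fun n : ℕ => (1 / (n : ℂ)) * ∑ i ∈ Finset.range n, f (T^[i + 1] x)) atTop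
      (𝓝 (∫ z, f z ∂μ))

/-- The shift transformation on one-sided sequences. -/
def shift {A : Type*} (x : ℕ → A) : ℕ → A := fun n => x (n + 1)

/-- The point `y` of the full shift over the finite alphabet `K` is generic for some ergodic
shift-invariant Borel probability measure. -/
def IsGenericForErgodic {K : Finset ℂ} (y : ℕ → K) : Prop :=
  ∃ ν : Measure (ℕ → K), IsProbabilityMeasure ν ∧ Ergodic shift ν ∧ IsGeneric shift ν y

end

end SeqCorr

/-! Changing `y` on a set of places of density at most `ε` moves `corr x y n` by at most `4 * ε`, so
positive correlations survive small changes. Both parts therefore follow from two facts. A strictly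
ergodic point is generic for an ergodic measure, namely the image of the unique invariant measure of
its system (`IsStrictlyErgodicSeq.isGenericForErgodic`). Conversely, a point generic for an ergodic
measure agrees with some strictly ergodic point up to density `ε`, with a bound valid on every
initial segment (`IsGenericForErgodic.exists_isStrictlyErgodicSeq`). The second fact is the
substance; it is a construction in the spirit of the Jewett–Krieger theorem, carried out on a single
sequence.

By the mean ergodic theorem a generic point satisfies `ErgSeq`: every set coded by it has nearly
constant frequency in most long windows (`IsGeneric.ergSeq`). The sequence `y` may be periodic and
so unable to mark sparse places. It is therefore paired with bits `b` that are normal relative to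
`y` (`exists_relatively_normal`); these come from a greedy choice of signs and a van der Corput
argument. The pair `w` still satisfies `ErgSeq`, and `b` codes cut sets with any prescribed spacing
(`exists_markers`).

In one step of the construction (`BlockStage.exists_refine`) the sequence is cut into long blocks.
Most of them have typical word frequencies and only receive a new short head containing a given
initial word; the few others are replaced entirely. The result is still coded by `w`, so the step
can be iterated with summable changes, longer words and smaller tolerances. New blocks are
concatenations of old ones, so uniformity once achieved is never lost. The limit has uniform
frequencies and bounded recurrence gaps (`ErgSeq.exists_uniform`), which make its orbit closure
uniquely ergodic and minimal (`isStrictlyErgodicSeq_of_uniform`). -/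

namespace SeqCorr

open Finset (range)

/-! ### Ergodicity of a single sequence -/

open Classical in
/-- The real-valued indicator of a proposition. -/
noncomputable def ind (P : Prop) : ℝ := if P then 1 else 0

lemma ind_nonneg (P : Prop) : 0 ≤ ind P := by
  unfold ind; split_ifs <;> norm_num

lemma ind_le_one (P : Prop) : ind P ≤ 1 := by
  unfold ind; split_ifs <;> norm_num

lemma ind_of {P : Prop} (h : P) : ind P = 1 := by simp [ind, h]

lemma ind_of_not {P : Prop} (h : ¬ P) : ind P = 0 := by simp [ind, h]

lemma ind_mono {P Q : Prop} (h : P → Q) : ind P ≤ ind Q := by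
  by_cases hP : P
  · rw [ind_of hP, ind_of (h hP)]
  · rw [ind_of_not hP]; exact ind_nonneg _

lemma abs_ind_sub_ind_le (P Q : Prop) : |ind P - ind Q| ≤ ind (P ≠ Q) := by
  by_cases hP : P <;> by_cases hQ : Q <;> simp [ind, hP, hQ]

/-- Averages of `g` over the windows of length `N`. -/
noncomputable def mavg (g : ℕ → ℝ) (N i : ℕ) : ℝ := (∑ j ∈ range N, g (i + j)) / N

/-- The averages of `g` over long windows are, for most windows, close to a constant. -/
def ErgMean (g : ℕ → ℝ) : Prop :=
  ∀ ε > 0, ∃ c : ℝ, ∀ᶠ N in atTop, ∀ᶠ n : ℕ in atTop, ∑ i ∈ range n, |mavg g N i - c| ≤ ε * n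

/-- `v` is given by a two-sided block code applied to `w`, away from the origin. -/
def LocalTo {B C : Type*} (v : ℕ → B) (w : ℕ → C) : Prop :=
  ∃ D : ℕ, ∀ i j, D ≤ i → D ≤ j → (∀ t ≤ 2 * D, w (i - D + t) = w (j - D + t)) → v i = v j

/-- `v` can be approximated in density by block codes applied to `w`. -/
def Factor {B C : Type*} (v : ℕ → B) (w : ℕ → C) : Prop :=
  ∀ η > 0, ∃ v' : ℕ → B, LocalTo v' w ∧ ∀ᶠ n : ℕ in atTop, ∑ i ∈ range n, ind (v i ≠ v' i) ≤ η * n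

/-- All sets coded by `w` have nearly constant frequency in most long windows. -/
def ErgSeq {B : Type*} (w : ℕ → B) : Prop :=
  ∀ v : ℕ → Prop, LocalTo v w → ErgMean (fun i => ind (v i))

lemma sum_ind_lt_le (D n : ℕ) : ∑ i ∈ range n, ind (i < D) ≤ D := by
  calc _ ≤ ∑ i ∈ range (D + n), ind (i < D) := Finset.sum_le_sum_of_subset_of_nonneg
        (Finset.range_subset_range.2 (by omega)) fun i _ _ => ind_nonneg _
    _ ≤ D := by
        rw [Finset.sum_range_add]
        simp only [add_lt_iff_neg_left, not_lt_zero, ind_of_not not_false, Finset.sum_const_zero,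
          add_zero]
        calc _ ≤ ∑ i ∈ range D, (1 : ℝ) := Finset.sum_le_sum fun i _ => ind_le_one _
          _ = D := by simp

lemma eventually_const_le {ε : ℝ} (hε : 0 < ε) (C : ℝ) : ∀ᶠ n : ℕ in atTop, C ≤ ε * n := by
  have := (tendsto_natCast_atTop_atTop (R := ℝ)).const_mul_atTop hε
  exact this.eventually_ge_atTop C

lemma mavg_add (f g : ℕ → ℝ) (N i : ℕ) :
    mavg (fun i => f i + g i) N i = mavg f N i + mavg g N i := by
  simp [mavg, Finset.sum_add_distrib, add_div]

lemma mavg_const_mul (a : ℝ) (f : ℕ → ℝ) (N i : ℕ) :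
    mavg (fun i => a * f i) N i = a * mavg f N i := by
  simp [mavg, ← Finset.mul_sum, mul_div_assoc]

lemma abs_mavg_le {g h : ℕ → ℝ} (hgh : ∀ i, |g i| ≤ h i) (N i : ℕ) :
    |mavg g N i| ≤ mavg h N i := by
  unfold mavg
  rw [abs_div, Nat.abs_cast]
  gcongr
  exact (Finset.abs_sum_le_sum_abs _ _).trans (Finset.sum_le_sum fun j _ => hgh _)

lemma sum_range_shift_le {h : ℕ → ℝ} (hh : ∀ i, 0 ≤ h i) (n j : ℕ) {m : ℕ} (hm : n + j ≤ m) :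
    ∑ i ∈ range n, h (i + j) ≤ ∑ i ∈ range m, h i := by
  calc ∑ i ∈ range n, h (i + j) ≤ ∑ i ∈ range (n + j), h i := by
        rw [add_comm n j, Finset.sum_range_add]
        have : 0 ≤ ∑ x ∈ range j, h x := Finset.sum_nonneg fun i _ => hh i
        simp only [add_comm j]
        linarith
    _ ≤ _ := Finset.sum_le_sum_of_subset_of_nonneg (Finset.range_subset_range.2 hm)
        fun i _ _ => hh i

lemma sum_mavg_le {h : ℕ → ℝ} (hh : ∀ i, 0 ≤ h i) (N n : ℕ) :
    ∑ i ∈ range n, mavg h N i ≤ ∑ i ∈ range (n + N), h i := by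
  unfold mavg
  rw [← Finset.sum_div, Finset.sum_comm]
  have h0 : 0 ≤ ∑ i ∈ range (n + N), h i := Finset.sum_nonneg fun i _ => hh i
  rcases Nat.eq_zero_or_pos N with rfl | hN
  · simpa using h0
  rw [div_le_iff₀ (by positivity)]
  calc _ ≤ ∑ j ∈ range N, ∑ i ∈ range (n + N), h i :=
        Finset.sum_le_sum fun j hj => sum_range_shift_le hh n j
          (by have := Finset.mem_range.1 hj; omega)
    _ = _ := by simp [mul_comm]

/-- Window averages of `g` and `g'` differ by at most those of `|g - g'|`, and `sum_mavg_le` bounds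
the sum of the latter by the sum of `|g - g'|` itself over a slightly longer range. -/
lemma ErgMean.of_approx {g : ℕ → ℝ}
    (h : ∀ η > 0, ∃ g', ErgMean g' ∧ ∀ᶠ n : ℕ in atTop, ∑ i ∈ range n, |g i - g' i| ≤ η * n) :
    ErgMean g := by
  intro ε hε
  obtain ⟨g', hg', hd⟩ := h (ε / 4) (by positivity)
  obtain ⟨c, hc⟩ := hg' (ε / 4) (by positivity)
  refine ⟨c, ?_⟩
  filter_upwards [hc] with N hN
  filter_upwards [hN, (tendsto_add_atTop_nat N).eventually hd, eventually_ge_atTop N]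
    with n h1 h2 h3
  have key : ∀ i, |mavg g N i - c| ≤ |mavg g' N i - c| + mavg (fun i => |g i - g' i|) N i := by
    intro i
    have e : mavg g N i - c = (mavg g' N i - c) + mavg (fun i => g i - g' i) N i := by
      have := mavg_add g' (fun i => g i - g' i) N i
      simp only [add_sub_cancel] at this
      rw [this]; ring
    rw [e]
    exact (abs_add_le _ _).trans (by gcongr; exact abs_mavg_le (fun i => le_rfl) N i)
  have h4 := sum_mavg_le (h := fun i => |g i - g' i|) (fun i => abs_nonneg _) N n
  have h5 := Finset.sum_le_sum fun i (_ : i ∈ range n) => key i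
  rw [Finset.sum_add_distrib] at h5
  have h6 : (N : ℝ) ≤ n := by exact_mod_cast h3
  push_cast at h2
  nlinarith

lemma ErgMean.add {f g : ℕ → ℝ} (hf : ErgMean f) (hg : ErgMean g) :
    ErgMean (fun i => f i + g i) := by
  intro ε hε
  obtain ⟨c, hc⟩ := hf (ε / 2) (by positivity)
  obtain ⟨d, hd⟩ := hg (ε / 2) (by positivity)
  refine ⟨c + d, ?_⟩
  filter_upwards [hc, hd] with N h1 h2
  filter_upwards [h1, h2] with n h3 h4
  calc _ ≤ ∑ i ∈ range n, (|mavg f N i - c| + |mavg g N i - d|) := by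
        refine Finset.sum_le_sum fun i _ => ?_
        rw [mavg_add, add_sub_add_comm]
        exact abs_add_le _ _
    _ ≤ ε * n := by rw [Finset.sum_add_distrib]; linarith

lemma ErgMean.const_mul {f : ℕ → ℝ} (hf : ErgMean f) (a : ℝ) : ErgMean (fun i => a * f i) := by
  intro ε hε
  obtain ⟨c, hc⟩ := hf (ε / (|a| + 1)) (by positivity)
  refine ⟨a * c, ?_⟩
  filter_upwards [hc] with N h1
  filter_upwards [h1] with n h3
  calc _ = |a| * ∑ i ∈ range n, |mavg f N i - c| := by
        rw [Finset.mul_sum]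
        refine Finset.sum_congr rfl fun i _ => ?_
        rw [mavg_const_mul, ← mul_sub, abs_mul]
    _ ≤ (|a| + 1) * (ε / (|a| + 1) * n) := by gcongr; linarith
    _ = ε * n := by field_simp

lemma ErgMean.zero : ErgMean (fun _ => 0) := by
  intro ε hε
  refine ⟨0, Eventually.of_forall fun N => Eventually.of_forall fun n => ?_⟩
  simp only [mavg, Finset.sum_const_zero, zero_div, sub_zero, abs_zero]
  positivity

lemma ErgMean.sum {ι : Type*} (s : Finset ι) {f : ι → ℕ → ℝ} (hf : ∀ a ∈ s, ErgMean (f a)) :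
    ErgMean (fun i => ∑ a ∈ s, f a i) := by
  classical
  induction s using Finset.induction_on with
  | empty => simpa using ErgMean.zero
  | insert a s ha ih =>
    simp only [Finset.sum_insert ha]
    exact (hf a (by simp)).add (ih fun b hb => hf b (by simp [hb]))

lemma ErgMean.of_shift {g : ℕ → ℝ} (k : ℕ) (h : ErgMean (fun i => g (i + k))) : ErgMean g := by
  intro ε hε
  obtain ⟨c, hc⟩ := h (ε / 2) (by positivity)
  refine ⟨c, ?_⟩
  filter_upwards [hc] with N h1
  filter_upwards [h1, eventually_const_le (half_pos hε) (∑ i ∈ range k, |mavg g N i - c|)]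
    with n h2 h3
  have h4 : ∑ i ∈ range n, |mavg g N i - c| ≤ ∑ i ∈ range (k + n), |mavg g N i - c| :=
    Finset.sum_le_sum_of_subset_of_nonneg (Finset.range_subset_range.2 (by omega))
      fun i _ _ => abs_nonneg _
  rw [Finset.sum_range_add] at h4
  have h5 : ∑ i ∈ range n, |mavg g N (k + i) - c|
      = ∑ i ∈ range n, |mavg (fun i => g (i + k)) N i - c| := by
    refine Finset.sum_congr rfl fun i _ => ?_
    simp only [mavg, add_assoc, add_comm k]
  linarith

/-! ### Block codes and their limits in density -/

section Local

variable {A B C : Type*}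

lemma LocalTo.exists_radius {v : ℕ → B} {w : ℕ → C} (h : LocalTo v w) : ∃ D₀ : ℕ, ∀ D, D₀ ≤ D →
    ∀ i j, D ≤ i → D ≤ j → (∀ t ≤ 2 * D, w (i - D + t) = w (j - D + t)) → v i = v j := by
  obtain ⟨D₀, h⟩ := h
  refine ⟨D₀, fun D hD i j hi hj hw => h i j (by omega) (by omega) fun t ht => ?_⟩
  have := hw (t + (D - D₀)) (by omega)
  rwa [show i - D + (t + (D - D₀)) = i - D₀ + t by omega,
    show j - D + (t + (D - D₀)) = j - D₀ + t by omega] at this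

lemma LocalTo.prodMk {u : ℕ → A} {v : ℕ → B} {w : ℕ → C} (hu : LocalTo u w) (hv : LocalTo v w) :
    LocalTo (fun i => (u i, v i)) w := by
  obtain ⟨D, hD⟩ := hu.exists_radius
  obtain ⟨E, hE⟩ := hv.exists_radius
  refine ⟨max D E, fun i j hi hj hw => ?_⟩
  exact Prod.ext (hD _ (le_max_left _ _) i j hi hj hw) (hE _ (le_max_right _ _) i j hi hj hw)

lemma LocalTo.trans {u : ℕ → A} {v : ℕ → B} {w : ℕ → C} (huv : LocalTo u v) (hvw : LocalTo v w) :
    LocalTo u w := by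
  obtain ⟨D, hD⟩ := huv
  obtain ⟨E, hE⟩ := hvw
  refine ⟨D + E, fun i j hi hj hw => hD i j (by omega) (by omega) fun t ht =>
    hE _ _ (by omega) (by omega) fun s hs => ?_⟩
  have := hw (t + s) (by omega)
  rwa [show i - (D + E) + (t + s) = i - D + t - E + s by omega,
    show j - (D + E) + (t + s) = j - D + t - E + s by omega] at this

lemma LocalTo.comp {v : ℕ → B} {w : ℕ → C} (h : LocalTo v w) (f : B → A) :
    LocalTo (fun i => f (v i)) w := by
  obtain ⟨D, hD⟩ := h
  exact ⟨D, fun i j hi hj hw => congrArg f (hD i j hi hj hw)⟩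

lemma LocalTo.refl (v : ℕ → B) : LocalTo v v :=
  ⟨0, fun i j _ _ h => by simpa using h 0 le_rfl⟩

/-- A block code can be applied to every sequence. -/
lemma LocalTo.transfer {u : ℕ → A} {v : ℕ → B} (h : LocalTo u v) : ∃ D : ℕ, ∀ v' : ℕ → B,
    ∃ u' : ℕ → A, LocalTo u' v' ∧
      ∀ i, D ≤ i → (∀ t ≤ 2 * D, v (i - D + t) = v' (i - D + t)) → u i = u' i := by
  classical
  obtain ⟨D, hD⟩ := h
  -- The code looks its argument up in `v` and copies the symbol of `u` found there; by `hD` the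
  -- choice of the occurrence is immaterial. Patterns absent from `v` get the irrelevant value `u
  -- 0`. Truncating indices at `2 * D` below makes the argument depend on the window only.
  let code : (ℕ → B) → A := fun W =>
    if h : ∃ j, D ≤ j ∧ ∀ t ≤ 2 * D, v (j - D + t) = W t then u h.choose else u 0
  refine ⟨D, fun v' => ⟨fun i => code fun t => v' (i - D + min t (2 * D)), ?_, ?_⟩⟩
  · refine ⟨D, fun i j hi hj hw => ?_⟩
    exact congrArg code (funext fun t => hw _ (min_le_right _ _))
  · intro i hi hw
    have hex : ∃ j, D ≤ j ∧ ∀ t ≤ 2 * D, v (j - D + t) = v' (i - D + min t (2 * D)) :=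
      ⟨i, hi, fun t ht => by rw [min_eq_left ht]; exact hw t ht⟩
    simp only [code]
    rw [dif_pos hex]
    refine hD _ _ hi hex.choose_spec.1 fun t ht => ?_
    rw [hex.choose_spec.2 t ht, min_eq_left ht, hw t ht]

/-- A union bound over the `2 * D + 1` places of the window; the one remaining `η` absorbs the
boundary effects. -/
lemma eventually_window {P : ℕ → Prop} {η : ℝ} (hη : 0 < η)
    (h : ∀ᶠ n : ℕ in atTop, ∑ i ∈ range n, ind (P i) ≤ η * n) (D : ℕ) :
    ∀ᶠ n : ℕ in atTop,
      ∑ i ∈ range n, ind (i < D ∨ ∃ t ≤ 2 * D, P (i - D + t)) ≤ (2 * D + 2) * η * n := by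
  filter_upwards [(tendsto_add_atTop_nat D).eventually h,
    eventually_const_le hη (D + (2 * D + 1) * (η * D)), eventually_ge_atTop D] with n h1 h2 h3
  obtain ⟨m, rfl⟩ := Nat.exists_eq_add_of_le h3
  rw [Finset.sum_range_add]
  have a1 : ∑ i ∈ range D, ind (i < D ∨ ∃ t ≤ 2 * D, P (i - D + t)) ≤ D := by
    calc _ ≤ ∑ i ∈ range D, (1 : ℝ) := Finset.sum_le_sum fun i _ => ind_le_one _
      _ = D := by simp
  have a2 : ∑ i ∈ range m, ind (D + i < D ∨ ∃ t ≤ 2 * D, P (D + i - D + t))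
      ≤ ∑ t ∈ range (2 * D + 1), ∑ i ∈ range m, ind (P (i + t)) := by
    rw [Finset.sum_comm]
    refine Finset.sum_le_sum fun i _ => ?_
    by_cases hP : D + i < D ∨ ∃ t ≤ 2 * D, P (D + i - D + t)
    · obtain hP | ⟨t, ht, hPt⟩ := hP
      · omega
      · refine (ind_le_one _).trans ?_
        rw [Nat.add_sub_cancel_left] at hPt
        rw [← ind_of hPt]
        exact Finset.single_le_sum (f := fun t => ind (P (i + t))) (fun t _ => ind_nonneg _)
          (Finset.mem_range.2 (by omega))
    · rw [ind_of_not hP]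
      exact Finset.sum_nonneg fun t _ => ind_nonneg _
  have a3 : ∑ t ∈ range (2 * D + 1), ∑ i ∈ range m, ind (P (i + t))
      ≤ (2 * D + 1) * (η * (m + D + D)) := by
    calc _ ≤ ∑ t ∈ range (2 * D + 1), η * (m + D + D : ℝ) := by
          refine Finset.sum_le_sum fun t ht => ?_
          have := Finset.mem_range.1 ht
          have h6 := sum_range_shift_le (h := fun i => ind (P i)) (fun i => ind_nonneg _) m t
            (m := D + m + D) (by omega)
          push_cast at h1
          linarith
      _ = _ := by simp
  push_cast at h1 h2 ⊢
  nlinarith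

lemma LocalTo.factor {u : ℕ → A} {v : ℕ → B} (h : LocalTo u v) : Factor u v := by
  intro η hη
  refine ⟨u, h, Eventually.of_forall fun n => ?_⟩
  simp only [ne_eq, not_true_eq_false, ind_of_not not_false, Finset.sum_const_zero]
  positivity

lemma Factor.of_approx {u : ℕ → A} {w : ℕ → C} (h : ∀ η > 0, ∃ u', Factor u' w ∧
    ∀ᶠ n : ℕ in atTop, ∑ i ∈ range n, ind (u i ≠ u' i) ≤ η * n) : Factor u w := by
  intro η hη
  obtain ⟨u', hu', h1⟩ := h (η / 2) (by positivity)
  obtain ⟨u'', hu'', h2⟩ := hu' (η / 2) (by positivity)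
  refine ⟨u'', hu'', ?_⟩
  filter_upwards [h1, h2] with n h1 h2
  calc _ ≤ ∑ i ∈ range n, (ind (u i ≠ u' i) + ind (u' i ≠ u'' i)) := by
        refine Finset.sum_le_sum fun i _ => ?_
        by_cases h : u i = u' i
        · rw [h]; linarith [ind_nonneg (u' i ≠ u' i)]
        · rw [ind_of (P := u i ≠ u' i) h]
          linarith [ind_nonneg (u' i ≠ u'' i), ind_le_one (u i ≠ u'' i)]
    _ ≤ η * n := by rw [Finset.sum_add_distrib]; linarith

lemma LocalTo.factor_trans {u : ℕ → A} {v : ℕ → B} {w : ℕ → C} (h : LocalTo u v)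
    (hv : Factor v w) : Factor u w := by
  intro η hη
  obtain ⟨D, hD⟩ := h.transfer
  obtain ⟨v', hv', h1⟩ := hv (η / (2 * D + 2)) (by positivity)
  obtain ⟨u', hu', h2⟩ := hD v'
  refine ⟨u', hu'.trans hv', ?_⟩
  filter_upwards [eventually_window (by positivity) h1 D] with n h3
  calc _ ≤ _ := ?_
    _ ≤ _ := h3
    _ = _ := by field_simp
  refine Finset.sum_le_sum fun i _ => ind_mono fun h => ?_
  by_contra! hc
  exact h (h2 i hc.1 hc.2)

lemma Factor.prodMk {u : ℕ → A} {v : ℕ → B} {w : ℕ → C} (hu : Factor u w) (hv : Factor v w) :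
    Factor (fun i => (u i, v i)) w := by
  intro η hη
  obtain ⟨u', hu', h1⟩ := hu (η / 2) (by positivity)
  obtain ⟨v', hv', h2⟩ := hv (η / 2) (by positivity)
  refine ⟨_, hu'.prodMk hv', ?_⟩
  filter_upwards [h1, h2] with n h1 h2
  calc _ ≤ ∑ i ∈ range n, (ind (u i ≠ u' i) + ind (v i ≠ v' i)) := by
        refine Finset.sum_le_sum fun i _ => ?_
        by_cases h : u i = u' i
        · have : ind ((u i, v i) ≠ (u' i, v' i)) ≤ ind (v i ≠ v' i) :=
            ind_mono fun hne hv => hne (by rw [h, hv])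
          linarith [ind_nonneg (u i ≠ u' i)]
        · rw [ind_of (P := u i ≠ u' i) h]
          linarith [ind_nonneg (v i ≠ v' i), ind_le_one ((u i, v i) ≠ (u' i, v' i))]
    _ ≤ η * n := by rw [Finset.sum_add_distrib]; linarith

lemma Factor.congr {u u' : ℕ → A} {w : ℕ → C} (h : Factor u w) (D : ℕ)
    (he : ∀ i, D ≤ i → u i = u' i) : Factor u' w := by
  refine Factor.of_approx fun η hη => ⟨u, h, ?_⟩
  filter_upwards [eventually_const_le hη D] with n hn
  refine le_trans ?_ hn
  calc _ ≤ ∑ i ∈ range n, ind (i < D) := Finset.sum_le_sum fun i _ => ind_mono fun h => by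
        by_contra hi; exact h (he i (by omega)).symm
    _ ≤ D := sum_ind_lt_le D n

lemma Factor.ergMean {v : ℕ → Prop} {w : ℕ → C} (h : Factor v w) (hw : ErgSeq w) :
    ErgMean (fun i => ind (v i)) := by
  refine ErgMean.of_approx fun η hη => ?_
  obtain ⟨v', hv', h1⟩ := h η hη
  refine ⟨_, hw v' hv', ?_⟩
  filter_upwards [h1] with n hn
  exact (Finset.sum_le_sum fun i _ => abs_ind_sub_ind_le _ _).trans hn

end Local

/-! ### Signs with small predictable transforms, and van der Corput -/

/-- Signs can be chosen one after the other such that all members of a countable family of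
predictable transforms grow at most like the square root. -/
lemma exists_signs (H : ℕ → ℕ → (ℕ → ℝ) → ℝ)
    (hloc : ∀ a n r r', (∀ i < n, r i = r' i) → H a n r = H a n r')
    (hb : ∀ a n r, (∀ i, r i = 1 ∨ r i = -1) → |H a n r| ≤ 1)
    (hz : ∀ a n r, n < a → H a n r = 0) :
    ∃ r : ℕ → ℝ, (∀ i, r i = 1 ∨ r i = -1) ∧
      ∀ a M : ℕ, (∑ n ∈ range M, r n * H a n r) ^ 2 ≤ 2 ^ (a + 1) * M := by
  classical
  let S : ℕ → ℕ → (ℕ → ℝ) → ℝ := fun a M r => ∑ n ∈ range M, r n * H a n r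
  -- A potential replaces the second moment of a random choice: if each new sign raises `Φ` by at
  -- most `1`, then `Φ ≤ M`, and each single term yields the bound with the factor `2 ^ (a + 1)`.
  let Φ : ℕ → (ℕ → ℝ) → ℝ := fun M r => ∑ a ∈ range M, (1 / 2) ^ (a + 1) * S a M r ^ 2
  have hS : ∀ a M r r', (∀ i < M, r i = r' i) → S a M r = S a M r' := by
    intro a M r r' h
    refine Finset.sum_congr rfl fun n hn => ?_
    have hn := Finset.mem_range.1 hn
    rw [h n hn, hloc a n r r' fun i hi => h i (hi.trans hn)]
  have hS0 : ∀ a M r, M ≤ a → S a M r = 0 := fun a M r h => Finset.sum_eq_zero fun n hn => by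
    rw [hz a n r (by have := Finset.mem_range.1 hn; omega), mul_zero]
  have step : ∀ M (ρ : ℕ → ℝ), (∀ i, ρ i = 1 ∨ ρ i = -1) → ∃ s : ℝ, (s = 1 ∨ s = -1) ∧
      Φ (M + 1) (Function.update ρ M s) ≤ Φ M ρ + 1 := by
    intro M ρ hρ
    let X := ∑ a ∈ range (M + 1), (1 / 2) ^ (a + 1) * (S a M ρ * H a M ρ)
    -- The new sign enters `Φ` through the cross term `2 * (s * X)` and a square term that is at
    -- most `1` in total; `s` is chosen to make the cross term nonpositive.
    obtain ⟨s, hs, hsX⟩ : ∃ s : ℝ, (s = 1 ∨ s = -1) ∧ s * X ≤ 0 := by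
      rcases le_total X 0 with h | h
      · exact ⟨1, by simp, by linarith⟩
      · exact ⟨-1, by simp, by linarith⟩
    refine ⟨s, hs, ?_⟩
    have hs2 : s ^ 2 = 1 := by rcases hs with h | h <;> rw [h] <;> norm_num
    have e1 : ∀ a, S a (M + 1) (Function.update ρ M s) = S a M ρ + s * H a M ρ := by
      intro a
      have h1 : ∀ i < M, Function.update ρ M s i = ρ i := fun i hi => by simp [hi.ne]
      simp only [S]
      rw [Finset.sum_range_succ]
      have := hS a M _ _ h1
      simp only [S] at this
      rw [this, hloc a M _ _ h1, Function.update_self]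
    have e2 : Φ M ρ = ∑ a ∈ range (M + 1), (1 / 2) ^ (a + 1) * S a M ρ ^ 2 := by
      rw [Finset.sum_range_succ, hS0 M M ρ le_rfl]
      simp [Φ]
    have e3 : Φ (M + 1) (Function.update ρ M s) = Φ M ρ + 2 * (s * X)
        + ∑ a ∈ range (M + 1), (1 / 2) ^ (a + 1) * H a M ρ ^ 2 := by
      rw [e2]
      simp only [Φ, X, Finset.mul_sum, ← Finset.sum_add_distrib, e1]
      refine Finset.sum_congr rfl fun a _ => ?_
      linear_combination (1 / 2) ^ (a + 1) * H a M ρ ^ 2 * hs2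
    have e4 : ∑ a ∈ range (M + 1), (1 / 2 : ℝ) ^ (a + 1) * H a M ρ ^ 2 ≤ 1 := by
      calc _ ≤ ∑ a ∈ range (M + 1), (1 / 2 : ℝ) ^ (a + 1) := by
            refine Finset.sum_le_sum fun a _ => ?_
            have := sq_le_one_iff_abs_le_one _ |>.2 (hb a M ρ hρ)
            exact mul_le_of_le_one_right (by positivity) this
        _ = (∑ a ∈ range (M + 1), (1 / 2 : ℝ) ^ a) * (1 / 2) := by
            rw [Finset.sum_mul]; simp only [pow_succ]
        _ ≤ 2 * (1 / 2) := by gcongr; exact sum_geometric_two_le _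
        _ = 1 := by norm_num
    linarith
  choose! s hs hsΦ using step
  -- In `ρ M` the signs before `M` have been chosen and all others are still `1`. Later stages keep
  -- them, so the diagonal `ρ (i + 1) i` is the required sequence.
  let ρ : ℕ → ℕ → ℝ := fun M => Nat.rec (fun _ => 1) (fun M f => Function.update f M (s M f)) M
  have hρs : ∀ M, ρ (M + 1) = Function.update (ρ M) M (s M (ρ M)) := fun M => rfl
  have hρ : ∀ M i, ρ M i = 1 ∨ ρ M i = -1 := by
    intro M
    induction M with
    | zero => exact fun i => Or.inl rfl
    | succ M ih =>
      intro i
      rw [hρs]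
      by_cases h : i = M
      · subst h; simpa using hs i _ ih
      · simpa [h] using ih i
  have hst : ∀ i d, ρ (i + 1 + d) i = ρ (i + 1) i := by
    intro i d
    induction d with
    | zero => rfl
    | succ d ih =>
      rw [← ih, show i + 1 + (d + 1) = (i + 1 + d) + 1 by ring, hρs,
        Function.update_of_ne (by omega)]
  have hΦ : ∀ M, Φ M (ρ M) ≤ M := by
    intro M
    induction M with
    | zero => simp [Φ]
    | succ M ih =>
      rw [hρs]
      push_cast
      linarith [hsΦ M (ρ M) (hρ M)]
  refine ⟨fun i => ρ (i + 1) i, fun i => hρ (i + 1) i, fun a M => ?_⟩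
  have h1 : ∀ a, S a M (fun i => ρ (i + 1) i) = S a M (ρ M) := fun a => hS a M _ _ fun i hi => by
    obtain ⟨d, rfl⟩ := Nat.exists_eq_add_of_le (show i + 1 ≤ M from hi)
    exact (hst i d).symm
  change S a M (fun i => ρ (i + 1) i) ^ 2 ≤ _
  rw [h1]
  rcases lt_or_ge a M with ha | ha
  · have h2 : (1 / 2) ^ (a + 1) * S a M (ρ M) ^ 2 ≤ Φ M (ρ M) :=
      Finset.single_le_sum (f := fun a => (1 / 2 : ℝ) ^ (a + 1) * S a M (ρ M) ^ 2)
        (fun a _ => by positivity) (Finset.mem_range.2 ha)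
    have h3 : (2 : ℝ) ^ (a + 1) * (1 / 2) ^ (a + 1) = 1 := by rw [← mul_pow]; norm_num
    calc (S a M (ρ M) ^ 2 : ℝ) = 2 ^ (a + 1) * ((1 / 2) ^ (a + 1) * S a M (ρ M) ^ 2) := by
          rw [← mul_assoc, h3, one_mul]
      _ ≤ 2 ^ (a + 1) * M := by gcongr; exact h2.trans (hΦ M)
  · rw [hS0 a M _ ha, zero_pow two_ne_zero]
    positivity

/-- The averages of `g` over long windows are small for most windows. -/
def NullMean (g : ℕ → ℝ) : Prop :=
  ∀ ε > 0, ∀ᶠ N in atTop, ∀ᶠ n : ℕ in atTop, ∑ i ∈ range n, |mavg g N i| ≤ ε * n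

lemma NullMean.ergMean {g : ℕ → ℝ} (h : NullMean g) : ErgMean g := fun ε hε =>
  ⟨0, by simpa using h ε hε⟩

lemma NullMean.add {f g : ℕ → ℝ} (hf : NullMean f) (hg : NullMean g) :
    NullMean (fun i => f i + g i) := by
  intro ε hε
  filter_upwards [hf (ε / 2) (by positivity), hg (ε / 2) (by positivity)] with N h1 h2
  filter_upwards [h1, h2] with n h3 h4
  calc _ ≤ ∑ i ∈ range n, (|mavg f N i| + |mavg g N i|) := by
        refine Finset.sum_le_sum fun i _ => ?_
        rw [mavg_add]
        exact abs_add_le _ _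
    _ ≤ ε * n := by rw [Finset.sum_add_distrib]; linarith

lemma NullMean.const_mul {f : ℕ → ℝ} (hf : NullMean f) (a : ℝ) :
    NullMean (fun i => a * f i) := by
  intro ε hε
  filter_upwards [hf (ε / (|a| + 1)) (by positivity)] with N h1
  filter_upwards [h1] with n h3
  calc _ = |a| * ∑ i ∈ range n, |mavg f N i| := by
        rw [Finset.mul_sum]
        refine Finset.sum_congr rfl fun i _ => ?_
        rw [mavg_const_mul, abs_mul]
    _ ≤ (|a| + 1) * (ε / (|a| + 1) * n) := by gcongr; linarith
    _ = ε * n := by field_simp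

lemma NullMean.sum {ι : Type*} (s : Finset ι) {f : ι → ℕ → ℝ} (hf : ∀ a ∈ s, NullMean (f a)) :
    NullMean (fun i => ∑ a ∈ s, f a i) := by
  classical
  induction s using Finset.induction_on with
  | empty =>
    intro ε hε
    refine Eventually.of_forall fun N => Eventually.of_forall fun n => ?_
    simp only [mavg, Finset.sum_empty, Finset.sum_const_zero, zero_div, abs_zero]
    positivity
  | insert a s ha ih =>
    simp only [Finset.sum_insert ha]
    exact (hf a (by simp)).add (ih fun b hb => hf b (by simp [hb]))

/-- A van der Corput type lemma: bounded sequences with vanishing autocorrelations have small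
averages over most long windows. -/
lemma nullMean_of_autocorr {g : ℕ → ℝ} (hg : ∀ i, |g i| ≤ 1)
    (h : ∀ k, 1 ≤ k → ∀ ε > 0, ∀ᶠ n : ℕ in atTop, |∑ i ∈ range n, g i * g (i + k)| ≤ ε * n) :
    NullMean g := by
  intro ε hε
  filter_upwards [eventually_const_le (sq_pos_of_pos hε) 2, eventually_ge_atTop 1] with N hN hN1
  have hN0 : (0 : ℝ) < N := by exact_mod_cast hN1
  have shifted : ∀ j k, 1 ≤ k → ∀ ε > 0, ∀ᶠ n : ℕ in atTop,
      ∑ i ∈ range n, g (i + j) * g (i + j + k) ≤ ε * n := by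
    intro j k hk ε hε
    filter_upwards [(tendsto_add_atTop_nat j).eventually (h k hk (ε / 2) (by positivity)),
      eventually_const_le (half_pos hε) (ε / 2 * j - ∑ i ∈ range j, g i * g (i + k))]
      with n h1 h2
    rw [add_comm n j, Finset.sum_range_add] at h1
    have := (abs_le.1 h1).2
    simp only [add_comm j] at this
    push_cast at this
    linarith
  have pairs : ∀ j k, ∀ᶠ n : ℕ in atTop, ∑ i ∈ range n, g (i + j) * g (i + k)
      ≤ (if j = k then (1 : ℝ) else 1 / N) * n := by
    have lt : ∀ j k, j < k → ∀ᶠ n : ℕ in atTop, ∑ i ∈ range n, g (i + j) * g (i + k)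
        ≤ 1 / N * n := by
      intro j k hjk
      obtain ⟨d, rfl⟩ := Nat.exists_eq_add_of_lt hjk
      filter_upwards [shifted j (d + 1) (by omega) (1 / N) (by positivity)] with n hn
      simpa only [add_assoc] using hn
    intro j k
    rcases lt_trichotomy j k with hjk | rfl | hjk
    · simpa [hjk.ne] using lt j k hjk
    · refine Eventually.of_forall fun n => ?_
      calc _ ≤ ∑ i ∈ range n, (1 : ℝ) := Finset.sum_le_sum fun i _ => by
            rw [← abs_mul_abs_self]
            exact mul_le_one₀ (hg _) (abs_nonneg _) (hg _)
        _ = _ := by simp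
    · simpa [hjk.ne', mul_comm] using lt k j hjk
  have all : ∀ᶠ n : ℕ in atTop, ∀ j ∈ range N, ∀ k ∈ range N,
      ∑ i ∈ range n, g (i + j) * g (i + k) ≤ (if j = k then (1 : ℝ) else 1 / N) * n := by
    simp only [Filter.eventually_all_finset]
    exact fun j _ k _ => pairs j k
  filter_upwards [all] with n hn
  -- Among the `N ^ 2` pairs of the expanded square, the `N` diagonal ones contribute at most `n`
  -- each and the others at most `n / N` each, together at most `2 * N * n`.
  have sq : ∑ i ∈ range n, mavg g N i ^ 2 ≤ 2 / N * n := by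
    have e : ∑ i ∈ range n, mavg g N i ^ 2
        = (∑ j ∈ range N, ∑ k ∈ range N, ∑ i ∈ range n, g (i + j) * g (i + k)) / N ^ 2 := by
      have : ∀ i, mavg g N i ^ 2 = (∑ j ∈ range N, ∑ k ∈ range N, g (i + j) * g (i + k)) / N ^ 2 := by
        intro i
        rw [mavg, div_pow, sq, Finset.sum_mul_sum]
      simp only [this]
      rw [← Finset.sum_div, Finset.sum_comm]
      simp only [Finset.sum_comm (s := range n)]
    rw [e, div_le_iff₀ (by positivity)]
    calc _ ≤ ∑ j ∈ range N, ∑ k ∈ range N, ((if j = k then 1 else 0) + 1 / N) * (n : ℝ) := by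
          refine Finset.sum_le_sum fun j hj => Finset.sum_le_sum fun k hk =>
            (hn j hj k hk).trans ?_
          gcongr
          have : (0 : ℝ) < 1 / N := by positivity
          split_ifs <;> linarith
      _ = ∑ j ∈ range N, 2 * (n : ℝ) := by
          refine Finset.sum_congr rfl fun j hj => ?_
          rw [← Finset.sum_mul, Finset.sum_add_distrib, Finset.sum_ite_eq, if_pos hj]
          congr 1
          simp only [Finset.sum_const, Finset.card_range, nsmul_eq_mul]
          field_simp
          norm_num
      _ = 2 / N * n * N ^ 2 := by
          simp only [Finset.sum_const, Finset.card_range, nsmul_eq_mul]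
          field_simp
  -- The inequality of the means passes from the mean square to the mean; `2 ≤ ε ^ 2 * N` then makes
  -- the second half at most `ε / 2 * n`.
  calc _ ≤ ∑ i ∈ range n, (ε / 2 + 1 / (2 * ε) * mavg g N i ^ 2) := by
        refine Finset.sum_le_sum fun i _ => ?_
        have h0 := sq_nonneg (|mavg g N i| - ε)
        rw [← sq_abs (mavg g N i)]
        have : ε / 2 + 1 / (2 * ε) * |mavg g N i| ^ 2 - |mavg g N i|
            = (|mavg g N i| - ε) ^ 2 / (2 * ε) := by field_simp; ring
        have : 0 ≤ (|mavg g N i| - ε) ^ 2 / (2 * ε) := by positivity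
        linarith
    _ = ε / 2 * n + 1 / (2 * ε) * ∑ i ∈ range n, mavg g N i ^ 2 := by
        rw [Finset.sum_add_distrib, ← Finset.mul_sum]
        simp [mul_comm]
    _ ≤ ε / 2 * n + 1 / (2 * ε) * (2 / N * n) := by gcongr
    _ ≤ ε / 2 * n + ε / 2 * n := by
        have : 1 / (2 * ε) * (2 / N) ≤ ε / 2 := by
          rw [div_mul_div_comm, one_mul, div_le_iff₀ (by positivity)]
          nlinarith
        rw [← mul_assoc]
        gcongr
    _ = ε * n := by ring

/-! ### Bits that are normal relative to a given sequence -/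

section Bits

variable {A : Type*}

/-- The indicator of the occurrence of the pattern `u` at the position `i`. -/
noncomputable def pat {m : ℕ} (y : ℕ → A) (u : Fin m → A) (i : ℕ) : ℝ :=
  ind (∀ t : Fin m, y (i + t) = u t)

lemma abs_pat_le {m : ℕ} (y : ℕ → A) (u : Fin m → A) (i : ℕ) : |pat y u i| ≤ 1 := by
  rw [pat, abs_of_nonneg (ind_nonneg _)]
  exact ind_le_one _

lemma abs_prod_sign {ι : Type*} {r : ι → ℝ} (hr : ∀ i, r i = 1 ∨ r i = -1) (s : Finset ι) :
    |∏ t ∈ s, r t| = 1 := by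
  rw [Finset.abs_prod]
  refine Finset.prod_eq_one fun t _ => ?_
  rcases hr t with h | h <;> rw [h] <;> norm_num

/-- By `nullMean_of_autocorr` it suffices to control the autocorrelations at each lag `h ≥ 1`. In
the product of the terms at `i` and `i + h`, the sign at `i + h + max T` occurs exactly once and all
other signs have smaller index. So the correlation sums are predictable transforms of the signs,
countably many in all, and `exists_signs` bounds them by a multiple of the square root. -/
lemma exists_signs_uncorrelated [Countable A] (y : ℕ → A) :
    ∃ r : ℕ → ℝ, (∀ i, r i = 1 ∨ r i = -1) ∧ ∀ (m : ℕ) (u : Fin m → A) (T : Finset ℕ),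
      T.Nonempty → NullMean (fun i => pat y u i * ∏ t ∈ T, r (i + t)) := by
  classical
  let ι := (Σ m : ℕ, (Fin m → A)) × Finset ℕ × ℕ
  have : Nonempty ι := ⟨⟨⟨0, Fin.elim0⟩, ∅, 0⟩⟩
  obtain ⟨en, hen⟩ := exists_surjective_nat ι
  let G : ι → ℕ → ℝ := fun a i => pat y a.1.2 i
  let q : ι → ℕ := fun a => a.2.2 + a.2.1.sup id
  -- The product of the terms at `i` and at `i` plus the lag, without its last sign, whose index is
  -- `i + q a`.
  let K : ι → ℕ → (ℕ → ℝ) → ℝ := fun a i r => G a i * G a (i + a.2.2) *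
    ((∏ t ∈ a.2.1, r (i + t)) * ∏ t ∈ a.2.1.erase (a.2.1.sup id), r (i + a.2.2 + t))
  let H : ℕ → ℕ → (ℕ → ℝ) → ℝ := fun a n r =>
    if a ≤ n ∧ q (en a) ≤ n ∧ 1 ≤ (en a).2.2 then K (en a) (n - q (en a)) r else 0
  have hT : ∀ (T : Finset ℕ), ∀ t ∈ T, t ≤ T.sup id := fun T t ht => Finset.le_sup (f := id) ht
  have H1 : ∀ a n r r', (∀ i < n, r i = r' i) → H a n r = H a n r' := by
    intro a n r r' hrr
    simp only [H]
    split_ifs with hc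
    · obtain ⟨-, hc1, hc2⟩ := hc
      simp only [K]
      have hq : q (en a) = (en a).2.2 + (en a).2.1.sup id := rfl
      congr 2
      · refine Finset.prod_congr rfl fun t ht => hrr _ ?_
        have := hT _ t ht
        omega
      · refine Finset.prod_congr rfl fun t ht => hrr _ ?_
        have h1 := hT _ t (Finset.mem_of_mem_erase ht)
        have h2 := Finset.ne_of_mem_erase ht
        omega
    · rfl
  have H2 : ∀ a n r, (∀ i, r i = 1 ∨ r i = -1) → |H a n r| ≤ 1 := by
    intro a n r hr
    simp only [H]
    split_ifs with hc
    · simp only [K]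
      rw [abs_mul, abs_mul, abs_mul, abs_prod_sign (fun t => hr _), abs_prod_sign (fun t => hr _)]
      simpa using mul_le_one₀ (abs_pat_le y _ _) (abs_nonneg _) (abs_pat_le y _ _)
    · simp
  have H3 : ∀ a n r, n < a → H a n r = 0 := by
    intro a n r hna
    simp only [H]
    rw [if_neg (by omega)]
  obtain ⟨r, hr, hrH⟩ := exists_signs H H1 H2 H3
  refine ⟨r, hr, fun m u T hTn => nullMean_of_autocorr (fun i => ?_) fun h hh ε hε => ?_⟩
  · rw [abs_mul, abs_prod_sign (fun t => hr (i + t)), mul_one]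
    exact abs_pat_le _ _ _
  obtain ⟨a, ha⟩ := hen ⟨⟨m, u⟩, T, h⟩
  set g : ℕ → ℝ := fun i => pat y u i * ∏ t ∈ T, r (i + t) with hgdef
  have hg1 : ∀ i, |g i| ≤ 1 := fun i => by
    rw [hgdef]
    simp only
    rw [abs_mul, abs_prod_sign (fun t => hr (i + t)), mul_one]
    exact abs_pat_le _ _ _
  set Q := h + T.sup id with hQ
  have hqa : q (en a) = Q := by rw [ha]
  -- Multiplying by `r (Q + i)` restores the erased sign. The terms with `Q + i < a`, which `H`
  -- suppresses, number at most `a`.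
  have term : ∀ i, r (Q + i) * H a (Q + i) r = g i * g (i + h) - ind (Q + i < a) * (g i * g (i + h)) := by
    intro i
    by_cases hai : a ≤ Q + i
    · rw [ind_of_not (by omega)]
      simp only [H]
      rw [if_pos ⟨hai, by omega, by rw [ha]; exact hh⟩, hqa, Nat.add_sub_cancel_left]
      simp only [K, G, ha, hgdef]
      have hmem : T.sup id ∈ T := by
        obtain ⟨t, ht, hte⟩ := Finset.exists_mem_eq_sup T hTn id
        rw [hte]; exact ht
      rw [← Finset.mul_prod_erase T (fun t => r (i + h + t)) hmem]
      rw [show i + h + T.sup id = Q + i by omega]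
      ring
    · rw [ind_of (by omega)]
      simp only [H]
      rw [if_neg (by omega)]
      ring
  have bound : ∀ n : ℕ, |∑ i ∈ range n, g i * g (i + h)|
      ≤ a + |∑ i ∈ range (Q + n), r i * H a i r| := by
    intro n
    have e1 : ∑ i ∈ range (Q + n), r i * H a i r
        = ∑ i ∈ range n, g i * g (i + h) - ∑ i ∈ range n, ind (Q + i < a) * (g i * g (i + h)) := by
      rw [Finset.sum_range_add, Finset.sum_eq_zero, zero_add, ← Finset.sum_sub_distrib]
      · exact Finset.sum_congr rfl fun i _ => term i
      · intro i hi
        have := Finset.mem_range.1 hi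
        simp only [H]
        rw [if_neg (by omega), mul_zero]
    have e2 : |∑ i ∈ range n, ind (Q + i < a) * (g i * g (i + h))| ≤ a := by
      calc _ ≤ ∑ i ∈ range n, |ind (Q + i < a) * (g i * g (i + h))| :=
            Finset.abs_sum_le_sum_abs _ _
        _ ≤ ∑ i ∈ range n, ind (i < a) := by
            refine Finset.sum_le_sum fun i _ => ?_
            rw [abs_mul, abs_mul, abs_of_nonneg (ind_nonneg _)]
            calc _ ≤ ind (Q + i < a) * 1 := by
                  gcongr
                  · exact ind_nonneg _
                  · exact mul_le_one₀ (hg1 _) (abs_nonneg _) (hg1 _)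
              _ ≤ _ := by rw [mul_one]; exact ind_mono fun h => by omega
        _ ≤ a := sum_ind_lt_le a n
    have := abs_add_le (∑ i ∈ range n, ind (Q + i < a) * (g i * g (i + h)))
      (∑ i ∈ range (Q + n), r i * H a i r)
    rw [e1, add_sub_cancel] at this
    rw [e1]
    linarith
  filter_upwards [eventually_const_le (half_pos hε) a,
    eventually_const_le (ε := ε ^ 2 / 4) (by positivity) (2 * 2 ^ (a + 1)),
    eventually_ge_atTop Q] with n h1 h2 h3
  have h4 : |∑ i ∈ range (Q + n), r i * H a i r| ≤ ε / 2 * n := by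
    refine abs_le_of_sq_le_sq ?_ (by positivity)
    have h5 := hrH a (Q + n)
    have h6 : (Q : ℝ) ≤ n := by exact_mod_cast h3
    push_cast at h5
    calc _ ≤ _ := h5
      _ ≤ 2 ^ (a + 1) * (n + n : ℝ) := by gcongr
      _ = 2 * 2 ^ (a + 1) * n := by ring
      _ ≤ ε ^ 2 / 4 * n * n := by gcongr
      _ = _ := by ring
  linarith [bound n]

end Bits

section Bits

variable {A : Type*}

/-- The sign attached to a bit. -/
def bsign (b : Bool) : ℝ := if b then 1 else -1

lemma ind_eq_bsign (b c : Bool) : ind (b = c) = (1 + bsign c * bsign b) / 2 := by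
  cases b <;> cases c <;> norm_num [ind, bsign]

lemma ind_forall {ι : Type*} [Fintype ι] (P : ι → Prop) : ind (∀ t, P t) = ∏ t, ind (P t) := by
  by_cases h : ∀ t, P t
  · rw [ind_of h, Finset.prod_eq_one fun t _ => ind_of (h t)]
  · obtain ⟨t, ht⟩ := not_forall.1 h
    rw [ind_of_not h, Finset.prod_eq_zero (Finset.mem_univ t) (ind_of_not ht)]

/-- The Walsh expansion of a cylinder: multiply out the factors `(1 + bsign (v t) * bsign (b (i +
t))) / 2`. The constant term is the Bernoulli frequency, and every other term is a nonempty product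
of signs, hence negligible in mean. -/
lemma pat_bool_eq {m : ℕ} (b : ℕ → Bool) (v : Fin m → Bool) (i : ℕ) :
    pat b v i = (1 / 2) ^ m * (1 + ∑ T ∈ (Finset.univ.powerset.erase ∅ : Finset (Finset (Fin m))),
      (∏ t ∈ T, bsign (v t)) * ∏ t ∈ T.map Fin.valEmbedding, bsign (b (i + t))) := by
  classical
  rw [pat, ind_forall]
  simp only [ind_eq_bsign, div_eq_mul_inv, Finset.prod_mul_distrib]
  rw [Finset.prod_one_add, Finset.prod_const, Finset.card_univ, Fintype.card_fin, mul_comm,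
    ← Finset.add_sum_erase _ _ (Finset.empty_mem_powerset _), Finset.prod_empty, one_mul]
  simp only [Finset.prod_map, Finset.prod_mul_distrib, Fin.valEmbedding_apply]

lemma ind_and (P Q : Prop) : ind (P ∧ Q) = ind P * ind Q := by
  by_cases hP : P <;> by_cases hQ : Q <;> simp [ind, hP, hQ]

/-- A sequence of bits which is generic for the Bernoulli measure relative to `y`. -/
lemma exists_relatively_normal [Finite A] {y : ℕ → A} (hy : ErgSeq y) :
    ∃ b : ℕ → Bool, ErgSeq (fun i => (y i, b i)) ∧ ∀ (m : ℕ) (v : Fin m → Bool),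
      NullMean (fun i => pat b v i - (1 / 2) ^ m) := by
  classical
  have := Fintype.ofFinite A
  obtain ⟨r, hr, hnull⟩ := exists_signs_uncorrelated y
  let b : ℕ → Bool := fun i => decide (r i = 1)
  have hb : ∀ i, bsign (b i) = r i := by
    intro i
    rcases hr i with h | h <;> norm_num [b, bsign, h]
  -- Relative normality: the bits are independent of the patterns in `y`. The empty pattern `u`
  -- gives normality of `b` itself.
  have hprod : ∀ (m : ℕ) (v : Fin m → Bool) (k : ℕ) (u : Fin k → A),
      NullMean (fun i => pat y u i * (pat b v i - (1 / 2) ^ m)) := by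
    intro m v k u
    have e : (fun i => pat y u i * (pat b v i - (1 / 2) ^ m)) = fun i =>
        ∑ T ∈ (Finset.univ.powerset.erase ∅ : Finset (Finset (Fin m))),
          ((1 / 2) ^ m * ∏ t ∈ T, bsign (v t)) *
            (pat y u i * ∏ t ∈ T.map Fin.valEmbedding, r (i + t)) := by
      funext i
      rw [pat_bool_eq]
      simp only [hb]
      rw [mul_add, mul_one, add_sub_cancel_left, Finset.mul_sum, Finset.mul_sum]
      exact Finset.sum_congr rfl fun T _ => by ring
    rw [e]
    refine NullMean.sum _ fun T hT => NullMean.const_mul (hnull k u _ ?_) _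
    rw [Finset.map_nonempty]
    exact Finset.nonempty_iff_ne_empty.2 (Finset.ne_of_mem_erase hT)
  refine ⟨b, fun s hs => ?_, fun m v => ?_⟩
  · obtain ⟨D, hD⟩ := hs
    refine ErgMean.of_shift D ?_
    let code : (Fin (2 * D + 1) → A × Bool) → ℝ := fun W =>
      ind (∃ j, D ≤ j ∧ (∀ t : Fin (2 * D + 1), (y (j - D + t), b (j - D + t)) = W t) ∧ s j)
    have e : (fun i => ind (s (i + D))) = fun i => ∑ W : Fin (2 * D + 1) → A × Bool,
        code W * (pat y (fun t => (W t).1) i * pat b (fun t => (W t).2) i) := by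
      funext i
      have hW : ∀ W : Fin (2 * D + 1) → A × Bool,
          pat y (fun t => (W t).1) i * pat b (fun t => (W t).2) i
            = ind (W = fun t : Fin (2 * D + 1) => (y (i + t), b (i + t))) := by
        intro W
        rw [pat, pat, ← ind_and]
        congr 1
        simp only [← forall_and, funext_iff, Prod.ext_iff, eq_comm]
      simp only [hW]
      rw [Finset.sum_eq_single (fun t : Fin (2 * D + 1) => (y (i + t), b (i + t)))]
      · rw [ind_of (P := _ = _) rfl, mul_one]
        simp only [code]
        congr 1
        rw [eq_iff_iff]
        constructor
        · intro h
          exact ⟨i + D, by omega, fun t => by simp, h⟩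
        · rintro ⟨j, hj, hjw, hsj⟩
          rw [← hD j (i + D) hj (by omega) fun t ht => ?_]
          · exact hsj
          · simpa using hjw ⟨t, by omega⟩
      · intro W _ hne
        rw [ind_of_not hne, mul_zero]
      · simp
    rw [e]
    refine ErgMean.sum _ fun W _ => ErgMean.const_mul ?_ _
    -- The bit pattern is replaced by its frequency, up to a null term; what remains is coded by `y`
    -- alone.
    have e2 : (fun i => pat y (fun t => (W t).1) i * pat b (fun t => (W t).2) i) = fun i =>
        (1 / 2) ^ (2 * D + 1) * pat y (fun t => (W t).1) i + pat y (fun t => (W t).1) i *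
          (pat b (fun t => (W t).2) i - (1 / 2) ^ (2 * D + 1)) := by
      funext i; ring
    rw [e2]
    refine ErgMean.add (ErgMean.const_mul ?_ _) (hprod _ _ _ _).ergMean
    refine hy (fun i => ∀ t : Fin (2 * D + 1), y (i + t) = (W t).1) ?_
    refine ⟨2 * D, fun i j hi hj hw => ?_⟩
    refine propext (forall_congr' fun t => ?_)
    have := hw (2 * D + t) (by omega)
    rw [show i - 2 * D + (2 * D + t) = i + t by omega,
      show j - 2 * D + (2 * D + t) = j + t by omega] at this
    rw [this]
  · have := hprod m v 0 Fin.elim0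
    have e : ∀ i, pat y Fin.elim0 i = 1 := fun i => ind_of fun t => t.elim0
    simpa only [e, one_mul] using this

end Bits

/-! ### Cut sets and markers -/

/-- `C` is a set of cut points containing `0`, with spacing at least `lo` and gaps at most `hi`. -/
def IsCut (C : Set ℕ) (lo hi : ℕ) : Prop :=
  0 ∈ C ∧ (∀ p ∈ C, ∀ q ∈ C, p < q → p + lo ≤ q) ∧ ∀ i, ∃ q ∈ C, i < q ∧ q ≤ i + hi

/-- Divide the stretches between consecutive markers into pieces of length `L`, up to the last
piece. -/
lemma IsCut.of_markers {M : Set ℕ} {L : ℕ} (hL : 1 ≤ L) (h0 : 0 ∈ M)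
    (hM : ∀ p ∈ M, ∀ q ∈ M, p < q → p + L ≤ q) :
    IsCut {i | ∃ m ∈ M, m ≤ i ∧ (∀ k ∈ M, m < k → i < k) ∧ L ∣ i - m ∧
      (i = m ∨ ∀ k ∈ M, i < k → i + L ≤ k)} L (2 * L) := by
  classical
  refine ⟨⟨0, h0, le_rfl, fun k _ h => h, by simp, Or.inl rfl⟩, ?_, ?_⟩
  · rintro p ⟨m, hm, hmp, hmk, hd, hp⟩ q ⟨m', hm', hmq, hmk', hd', hq⟩ hpq
    rcases lt_trichotomy m m' with h | rfl | h
    · have h1 := hmk m' hm' h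
      rcases hp with rfl | hp
      · have := hM p hm m' hm' h; omega
      · have := hp m' hm' h1; omega
    · have : L ∣ (q - m) - (p - m) := Nat.dvd_sub hd' hd
      have := Nat.le_of_dvd (by omega) this
      omega
    · have := hmk' m hm h; omega
  · intro i
    let m := Nat.findGreatest (· ∈ M) i
    have hm : m ∈ M := Nat.findGreatest_spec (P := (· ∈ M)) (Nat.zero_le i) h0
    have hmi : m ≤ i := Nat.findGreatest_le i
    have hmax : ∀ k ∈ M, m < k → i < k := fun k hk hmk => by
      by_contra! hki
      exact Nat.findGreatest_is_greatest hmk hki hk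
    have hdm := Nat.div_add_mod (i - m) L
    have hml := Nat.mod_lt (i - m) hL
    set x := m + L * ((i - m) / L + 1) with hx
    have hx' : x = m + L * ((i - m) / L) + L := by rw [hx]; ring
    -- Here `x` is the next grid point after `i`, so `x ≤ i + L`. A marker before `x + L` serves as
    -- the next point; otherwise `x` is itself a cut point.
    by_cases hk : ∃ k ∈ M, i < k ∧ k < x + L
    · obtain ⟨k, hkM, hik, hkx⟩ := hk
      exact ⟨k, ⟨k, hkM, le_rfl, fun _ _ h => h, by simp, Or.inl rfl⟩, hik, by omega⟩
    · push Not at hk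
      refine ⟨x, ⟨m, hm, by omega, fun k hkM hmk => ?_, ⟨(i - m) / L + 1, by omega⟩,
        Or.inr fun k hkM hxk => hk k hkM (by omega)⟩, by omega, by omega⟩
      have := hk k hkM (hmax k hkM hmk)
      omega

/-- A normal sequence of bits codes cut sets with arbitrary spacing. -/
lemma exists_markers {B : Type*} {w : ℕ → B} {b : ℕ → Bool} (hbw : LocalTo b w)
    (hb : ∀ (m : ℕ) (v : Fin m → Bool), NullMean (fun i => pat b v i - (1 / 2) ^ m))
    {L : ℕ} (hL : 1 ≤ L) : ∃ ρ : Set ℕ, IsCut ρ L (2 * L) ∧ Factor (fun i => i ∈ ρ) w := by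
  classical
  -- The pattern of `L - 1` zeros and a final one cannot overlap itself, so its occurrences are at
  -- least `L` apart.
  let v : Fin L → Bool := fun t => decide ((t : ℕ) + 1 = L)
  let Mk : ℕ → Prop := fun i => ∀ t : Fin L, b (i + t) = v t
  have hMk : ∀ p q, Mk p → Mk q → p < q → p + L ≤ q := by
    intro p q hp hq hpq
    by_contra! hc
    have h1 := hp ⟨L - 1, by omega⟩
    have h2 := hq ⟨p + L - 1 - q, by omega⟩
    simp only [v] at h1 h2
    rw [decide_eq_true (by omega)] at h1
    rw [decide_eq_false (by omega), show q + (p + L - 1 - q) = p + (L - 1) by omega] at h2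
    simp [h1] at h2
  -- The origin is a forced marker; occurrences closer than `L` to it are discarded to keep the
  -- spacing.
  let M : Set ℕ := {i | i = 0 ∨ L ≤ i ∧ Mk i}
  have hM : ∀ p ∈ M, ∀ q ∈ M, p < q → p + L ≤ q := by
    rintro p (rfl | ⟨hpL, hp⟩) q (rfl | ⟨hqL, hq⟩) hpq
    · omega
    · omega
    · omega
    · exact hMk p q hp hq hpq
  refine ⟨_, IsCut.of_markers hL (Or.inl rfl) hM, fun η hη => ?_⟩
  obtain ⟨N, hN, hN1⟩ := ((hb L v (η * (1 / 2) ^ L / 2) (by positivity)).and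
    (eventually_ge_atTop 1)).exists
  -- The local version of the cut set searches for the last marker only `N` places back and for the
  -- next one less than `L` ahead. Away from the origin it can err only where the last `N` places
  -- contain no marker.
  let loc : ℕ → Prop := fun i => ∃ t ≤ N, Mk (i - t) ∧ (∀ s < t, ¬ Mk (i - s)) ∧ L ∣ t ∧
    (t = 0 ∨ ∀ s < L, 0 < s → ¬ Mk (i + s))
  refine ⟨loc, LocalTo.trans ⟨N + 2 * L, fun i j hi hj hw => ?_⟩ hbw, ?_⟩
  · have hb : ∀ s ≤ N + 2 * L, b (i - N + s) = b (j - N + s) := by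
      intro s hs
      have := hw (2 * L + s) (by omega)
      rwa [show i - (N + 2 * L) + (2 * L + s) = i - N + s by omega,
        show j - (N + 2 * L) + (2 * L + s) = j - N + s by omega] at this
    have e1 : ∀ t ≤ N, Mk (i - t) = Mk (j - t) := by
      intro t ht
      refine propext (forall_congr' fun s => ?_)
      have := hb (N - t + s) (by omega)
      rw [show i - t + s = i - N + (N - t + s) by omega, this,
        show j - N + (N - t + s) = j - t + s by omega]
    have e2 : ∀ t < L, Mk (i + t) = Mk (j + t) := by
      intro t ht
      refine propext (forall_congr' fun s => ?_)
      have := hb (N + t + s) (by omega)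
      rw [show i + t + s = i - N + (N + t + s) by omega, this,
        show j - N + (N + t + s) = j + t + s by omega]
    simp only [loc]
    refine propext (exists_congr fun t => and_congr_right fun ht => ?_)
    rw [e1 t ht]
    refine and_congr_right fun _ => and_congr ?_ (and_congr_right fun _ => or_congr_right ?_)
    · exact forall₂_congr fun s hs => by rw [e1 s (by omega)]
    · exact forall₂_congr fun s hs => by rw [e2 s hs]
  have agree : ∀ i, N + 2 * L ≤ i → (∃ t ≤ N, Mk (i - t)) → ((∃ m ∈ M, m ≤ i ∧
      (∀ k ∈ M, m < k → i < k) ∧ L ∣ i - m ∧ (i = m ∨ ∀ k ∈ M, i < k → i + L ≤ k)) ↔ loc i) := by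
    rintro i hi ⟨t₀, ht₀, hMt₀⟩
    constructor
    · rintro ⟨m, hm, hmi, hmk, hd, hor⟩
      have h1 : i - t₀ ≤ m := by
        by_contra! hc
        have := hmk (i - t₀) (Or.inr ⟨by omega, hMt₀⟩) hc
        omega
      have hmM : Mk m := by
        rcases hm with rfl | hm
        · omega
        · exact hm.2
      refine ⟨i - m, by omega, by rwa [Nat.sub_sub_self hmi], fun s hs hMs => ?_, hd, ?_⟩
      · have := hmk (i - s) (Or.inr ⟨by omega, hMs⟩) (by omega)
        omega
      · rcases hor with h | h
        · left; omega
        · right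
          intro s hs hs0 hMs
          have := h (i + s) (Or.inr ⟨by omega, hMs⟩) (by omega)
          omega
    · rintro ⟨t, ht, hMt, hnt, hd, hor⟩
      refine ⟨i - t, Or.inr ⟨by omega, hMt⟩, by omega, ?_, by rwa [Nat.sub_sub_self (by omega)], ?_⟩
      · rintro k (rfl | ⟨-, hk⟩) hlt
        · omega
        · by_contra! hc
          refine hnt (i - k) (by omega) ?_
          rwa [Nat.sub_sub_self hc]
      · rcases hor with rfl | h
        · left; rfl
        · right
          rintro k (rfl | ⟨-, hk⟩) hlt
          · omega
          · by_contra! hc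
            refine h (k - i) (by omega) (by omega) ?_
            rwa [Nat.add_sub_cancel' hlt.le]
  have pointwise : ∀ i, ind ((N + i ∈ {i | ∃ m ∈ M, m ≤ i ∧ (∀ k ∈ M, m < k → i < k) ∧ L ∣ i - m ∧
      (i = m ∨ ∀ k ∈ M, i < k → i + L ≤ k)}) ≠ loc (N + i))
      ≤ ind (i < 2 * L) + 2 ^ L * |mavg (fun i => pat b v i - (1 / 2) ^ L) N i| := by
    intro i
    by_cases hiL : i < 2 * L
    · rw [ind_of hiL]
      refine (ind_le_one _).trans ?_
      have : 0 ≤ 2 ^ L * |mavg (fun i => pat b v i - (1 / 2) ^ L) N i| := by positivity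
      linarith
    rw [ind_of_not hiL, zero_add]
    by_cases hex : ∃ t ≤ N, Mk (N + i - t)
    · rw [ind_of_not]
      · positivity
      · rw [not_not]
        exact propext (agree (N + i) (by omega) hex)
    · push Not at hex
      -- Without a marker the window average misses the expected frequency by all of `(1 / 2) ^ L`.
      -- By Markov's inequality such windows are rare; this fixes the tolerance with which `N` was
      -- chosen.
      have hmean : mavg (fun i => pat b v i - (1 / 2) ^ L) N i = -(1 / 2) ^ L := by
        have : ∀ j ∈ range N, pat b v (i + j) - (1 / 2) ^ L = -(1 / 2) ^ L := by
          intro j hj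
          have hj := Finset.mem_range.1 hj
          have := hex (N - j) (by omega)
          rw [show N + i - (N - j) = i + j by omega] at this
          rw [pat, ind_of_not this, zero_sub]
        have hN0 : (N : ℝ) ≠ 0 := by positivity
        rw [mavg, Finset.sum_congr rfl this, Finset.sum_const, Finset.card_range, nsmul_eq_mul,
          mul_div_cancel_left₀ _ hN0]
      rw [hmean, abs_neg, abs_of_nonneg (by positivity), ← mul_pow]
      norm_num
      exact ind_le_one _
  filter_upwards [hN, eventually_const_le (half_pos hη) (N + 2 * L), eventually_ge_atTop N]
    with n h1 h2 h3
  obtain ⟨m, rfl⟩ := Nat.exists_eq_add_of_le h3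
  rw [Finset.sum_range_add]
  have s1 := Finset.sum_le_sum fun i (_ : i ∈ range m) => pointwise i
  rw [Finset.sum_add_distrib, ← Finset.mul_sum] at s1
  have s2 := sum_ind_lt_le (2 * L) m
  have s3 : ∑ i ∈ range m, |mavg (fun i => pat b v i - (1 / 2) ^ L) N i|
      ≤ ∑ i ∈ range (N + m), |mavg (fun i => pat b v i - (1 / 2) ^ L) N i| :=
    Finset.sum_le_sum_of_subset_of_nonneg (Finset.range_subset_range.2 (by omega))
      fun _ _ _ => abs_nonneg _
  have s4 : ∑ i ∈ range m, 2 ^ L * |mavg (fun i => pat b v i - (1 / 2) ^ L) N i|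
      ≤ η / 2 * (N + m : ℕ) := by
    rw [← Finset.mul_sum]
    calc _ ≤ 2 ^ L * (η * (1 / 2) ^ L / 2 * (N + m : ℕ)) := by gcongr; exact s3.trans h1
      _ = (2 ^ L * (1 / 2) ^ L) * (η / 2 * (N + m : ℕ)) := by ring
      _ = _ := by rw [← mul_pow]; norm_num
  have s5 : ∀ P : ℕ → Prop, ∑ i ∈ range N, ind (P i) ≤ N := fun P => by
    calc _ ≤ ∑ i ∈ range N, (1 : ℝ) := Finset.sum_le_sum fun i _ => ind_le_one _
      _ = N := by simp
  have s6 := s5 fun i => (i ∈ {i | ∃ m ∈ M, m ≤ i ∧ (∀ k ∈ M, m < k → i < k) ∧ L ∣ i - m ∧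
      (i = m ∨ ∀ k ∈ M, i < k → i + L ≤ k)}) ≠ loc i
  rw [Finset.mul_sum] at s1
  refine (add_le_add s6 s1).trans ?_
  push_cast at s2 s4 h2 ⊢
  linarith

/-! ### Words and counting their occurrences -/

section Words

variable {A : Type*}

/-- The word of length `m` occurring in `y` at the position `p`. -/
def word (y : ℕ → A) (p m : ℕ) : List A := (List.range m).map fun t => y (p + t)

@[simp] lemma length_word (y : ℕ → A) (p m : ℕ) : (word y p m).length = m := by simp [word]

lemma word_eq_word_iff {y y' : ℕ → A} {p p' m : ℕ} :
    word y p m = word y' p' m ↔ ∀ t < m, y (p + t) = y' (p' + t) := by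
  simp [word]

lemma word_add (y : ℕ → A) (p m n : ℕ) : word y p (m + n) = word y p m ++ word y (p + m) n := by
  simp [word, List.range_add, List.map_append, Function.comp_def, add_assoc]

lemma word_drop (y : ℕ → A) (p m j : ℕ) : (word y p m).drop j = word y (p + j) (m - j) := by
  rcases le_total j m with h | h
  · obtain ⟨k, rfl⟩ := Nat.exists_eq_add_of_le h
    rw [word_add, List.drop_append_of_le_length (by simp), List.drop_eq_nil_of_le (by simp)]
    simp
  · rw [List.drop_eq_nil_of_le (by simpa using h), Nat.sub_eq_zero_of_le h]
    rfl

lemma word_getElem? (y : ℕ → A) (p : ℕ) {m t : ℕ} (ht : t < m) :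
    (word y p m)[t]? = some (y (p + t)) := by
  simp [word, ht]

lemma prefix_word_iff {y : ℕ → A} {p m : ℕ} {u : List A} :
    u <+: word y p m ↔ u.length ≤ m ∧ word y p u.length = u := by
  constructor
  · intro h
    have hl := h.length_le
    rw [length_word] at hl
    refine ⟨hl, ?_⟩
    obtain ⟨k, hk⟩ := Nat.exists_eq_add_of_le hl
    rw [hk, word_add] at h
    have := List.prefix_of_prefix_length_le h (List.prefix_append _ _) (by simp)
    exact (this.eq_of_length (by simp)).symm
  · rintro ⟨hl, h⟩
    obtain ⟨k, hk⟩ := Nat.exists_eq_add_of_le hl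
    rw [hk, word_add, h]
    exact List.prefix_append _ _

/-- The number of occurrences of `u` in `v`. -/
noncomputable def occ (u v : List A) : ℝ := ∑ j ∈ range v.length, ind (u <+: v.drop j)

lemma occ_append_eq (u v₁ v₂ : List A) :
    occ u (v₁ ++ v₂) = ∑ j ∈ range v₁.length, ind (u <+: (v₁ ++ v₂).drop j) + occ u v₂ := by
  rw [occ, List.length_append, Finset.sum_range_add, occ]
  simp only [List.drop_append, Nat.add_sub_cancel_left, List.drop_eq_nil_of_le (Nat.le_add_right _ _),
    List.nil_append]

lemma occ_le_occ_append_left (u v₁ v₂ : List A) : occ u v₂ ≤ occ u (v₁ ++ v₂) := by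
  rw [occ_append_eq]
  have : 0 ≤ ∑ j ∈ range v₁.length, ind (u <+: (v₁ ++ v₂).drop j) :=
    Finset.sum_nonneg fun _ _ => ind_nonneg _
  linarith

lemma occ_append_le_length_add (u v₁ v₂ : List A) :
    occ u (v₁ ++ v₂) ≤ v₁.length + occ u v₂ := by
  rw [occ_append_eq]
  have : ∑ j ∈ range v₁.length, ind (u <+: (v₁ ++ v₂).drop j) ≤ ∑ j ∈ range v₁.length, (1 : ℝ) :=
    Finset.sum_le_sum fun _ _ => ind_le_one _
  simp only [Finset.sum_const, Finset.card_range, nsmul_eq_mul, mul_one] at this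
  linarith

lemma sum_ind_tail_le (m k : ℕ) : ∑ j ∈ range m, ind (m < j + k) ≤ k := by
  rcases le_total m k with h | h
  · calc _ ≤ ∑ j ∈ range m, (1 : ℝ) := Finset.sum_le_sum fun i _ => ind_le_one _
      _ = m := by simp
      _ ≤ k := by exact_mod_cast h
  · obtain ⟨d, rfl⟩ := Nat.exists_eq_add_of_le' h
    rw [Finset.sum_range_add, Finset.sum_eq_zero, zero_add]
    · calc _ ≤ ∑ j ∈ range k, (1 : ℝ) := Finset.sum_le_sum fun i _ => ind_le_one _
        _ = k := by simp
    · intro j hj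
      have := Finset.mem_range.1 hj
      exact ind_of_not (by omega)

lemma occ_add_occ_le (u v₁ v₂ : List A) : occ u v₁ + occ u v₂ ≤ occ u (v₁ ++ v₂) := by
  rw [occ_append_eq, occ]
  gcongr with j hj
  refine ind_mono fun h => h.trans ?_
  rw [List.drop_append]
  exact List.prefix_append _ _

/-- Only occurrences across the junction are new, and they start among the last `u.length` places of
`v₁`. -/
lemma occ_append_le (u v₁ v₂ : List A) :
    occ u (v₁ ++ v₂) ≤ occ u v₁ + occ u v₂ + u.length := by
  have h1 : ∑ j ∈ range v₁.length, ind (u <+: (v₁ ++ v₂).drop j)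
      ≤ ∑ j ∈ range v₁.length, (ind (u <+: v₁.drop j) + ind (v₁.length < j + u.length)) := by
    refine Finset.sum_le_sum fun j hj => ?_
    have hj := Finset.mem_range.1 hj
    by_cases h : v₁.length < j + u.length
    · rw [ind_of h]
      linarith [ind_le_one (u <+: (v₁ ++ v₂).drop j), ind_nonneg (u <+: v₁.drop j)]
    · rw [ind_of_not h, add_zero]
      refine ind_mono fun hp => ?_
      rw [List.drop_append] at hp
      exact List.prefix_of_prefix_length_le hp (List.prefix_append _ _) (by simp; omega)
  rw [Finset.sum_add_distrib] at h1
  have := sum_ind_tail_le v₁.length u.length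
  rw [occ_append_eq]
  have h2 : occ u v₁ = ∑ j ∈ range v₁.length, ind (u <+: v₁.drop j) := rfl
  linarith

lemma occ_word_le (y : ℕ → A) (u : List A) (p m : ℕ) :
    occ u (word y p m) ≤ ∑ j ∈ range m, ind (word y (p + j) u.length = u) := by
  rw [occ, length_word]
  refine Finset.sum_le_sum fun j _ => ind_mono fun h => ?_
  rw [word_drop, prefix_word_iff] at h
  exact h.2

lemma le_occ_word (y : ℕ → A) (u : List A) (p m : ℕ) :
    ∑ j ∈ range m, ind (word y (p + j) u.length = u) ≤ occ u (word y p m) + u.length := by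
  have h1 : ∑ j ∈ range m, ind (word y (p + j) u.length = u)
      ≤ ∑ j ∈ range m, (ind (u <+: (word y p m).drop j) + ind (m < j + u.length)) := by
    refine Finset.sum_le_sum fun j hj => ?_
    have hj := Finset.mem_range.1 hj
    by_cases h : m < j + u.length
    · rw [ind_of h]
      linarith [ind_le_one (word y (p + j) u.length = u), ind_nonneg (u <+: (word y p m).drop j)]
    · rw [ind_of_not h, add_zero]
      refine ind_mono fun hp => ?_
      rw [word_drop, prefix_word_iff]
      exact ⟨by omega, hp⟩
  rw [Finset.sum_add_distrib] at h1
  have := sum_ind_tail_le m u.length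
  rw [occ, length_word]
  linarith

/-- A block is typical if most of its windows are. -/
lemma abs_sum_sub_le {g : ℕ → ℝ} (h0 : ∀ i, 0 ≤ g i) (h1 : ∀ i, g i ≤ 1) (c : ℝ) {N : ℕ}
    (hN : 1 ≤ N) (p l : ℕ) :
    |∑ j ∈ range l, g (p + j) - c * l| ≤ ∑ j ∈ range l, |mavg g N (p + j) - c| + N := by
  have hN0 : (0 : ℝ) < N := by exact_mod_cast hN
  have le_card : ∀ q s : ℕ, ∑ t ∈ range s, g (q + t) ≤ s := fun q s => by
    calc _ ≤ ∑ t ∈ range s, (1 : ℝ) := Finset.sum_le_sum fun i _ => h1 _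
      _ = s := by simp
  -- A shift by `s` affects the sum only at its two ends. Averaging over `s < N` then compares the
  -- sum of `g` with the sum of its window averages.
  have hs : ∀ s ∈ range N, |∑ j ∈ range l, g (p + j + s) - ∑ j ∈ range l, g (p + j)| ≤ N := by
    intro s hs
    have hsN : (s : ℝ) ≤ N := by exact_mod_cast (Finset.mem_range.1 hs).le
    have e1 := Finset.sum_range_add (fun j => g (p + j)) l s
    have e2 := Finset.sum_range_add (fun j => g (p + j)) s l
    rw [add_comm s l] at e2
    have e3 : ∑ j ∈ range l, g (p + j + s) = ∑ j ∈ range l, g (p + (s + j)) :=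
      Finset.sum_congr rfl fun j _ => by congr 1; ring
    have b1 := le_card p s
    have b2 := le_card (p + l) s
    simp only [add_assoc] at b2
    have b3 : 0 ≤ ∑ t ∈ range s, g (p + t) := Finset.sum_nonneg fun _ _ => h0 _
    have b4 : 0 ≤ ∑ t ∈ range s, g (p + (l + t)) := Finset.sum_nonneg fun _ _ => h0 _
    rw [e3, abs_le]
    constructor <;> linarith
  have h2 : |∑ j ∈ range l, mavg g N (p + j) - ∑ j ∈ range l, g (p + j)| ≤ N := by
    have e : ∑ j ∈ range l, mavg g N (p + j) - ∑ j ∈ range l, g (p + j)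
        = (∑ s ∈ range N, (∑ j ∈ range l, g (p + j + s) - ∑ j ∈ range l, g (p + j))) / N := by
      rw [Finset.sum_sub_distrib, Finset.sum_comm, Finset.sum_const, Finset.card_range, sub_div,
        nsmul_eq_mul, mul_div_cancel_left₀ _ hN0.ne', Finset.sum_div]
      rfl
    rw [e, abs_div, Nat.abs_cast, div_le_iff₀ hN0]
    calc _ ≤ ∑ s ∈ range N, |∑ j ∈ range l, g (p + j + s) - ∑ j ∈ range l, g (p + j)| :=
          Finset.abs_sum_le_sum_abs _ _
      _ ≤ ∑ s ∈ range N, (N : ℝ) := Finset.sum_le_sum hs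
      _ = N * N := by simp
  have h3 : |∑ j ∈ range l, mavg g N (p + j) - c * l| ≤ ∑ j ∈ range l, |mavg g N (p + j) - c| := by
    have : ∑ j ∈ range l, mavg g N (p + j) - c * l = ∑ j ∈ range l, (mavg g N (p + j) - c) := by
      rw [Finset.sum_sub_distrib]; simp [mul_comm]
    rw [this]
    exact Finset.abs_sum_le_sum_abs _ _
  rw [abs_le] at *
  constructor <;> linarith

end Words

/-! ### Operations on cut sets and blocks -/

section Cuts

variable {A B : Type*}

/-- `p` and `q` are consecutive cut points. -/
def Consec (C : Set ℕ) (p q : ℕ) : Prop := p ∈ C ∧ q ∈ C ∧ p < q ∧ ∀ k ∈ C, p < k → q ≤ k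

variable {C : Set ℕ} {lo hi : ℕ}

lemma IsCut.exists_consec (hC : IsCut C lo hi) (i : ℕ) : ∃ p q, Consec C p q ∧ p ≤ i ∧ i < q := by
  classical
  obtain ⟨h0, -, hex⟩ := hC
  have hex' : ∃ q, q ∈ C ∧ i < q := by
    obtain ⟨q, hq, hiq, -⟩ := hex i
    exact ⟨q, hq, hiq⟩
  let p := Nat.findGreatest (· ∈ C) i
  have hpi : p ≤ i := Nat.findGreatest_le i
  have hpC : p ∈ C := Nat.findGreatest_spec (P := (· ∈ C)) (Nat.zero_le i) h0
  have hq := Nat.find_spec hex'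
  refine ⟨p, Nat.find hex', ⟨hpC, hq.1, by omega, fun k hk hpk => ?_⟩, hpi, hq.2⟩
  refine Nat.find_min' hex' ⟨hk, ?_⟩
  by_contra! hki
  exact Nat.findGreatest_is_greatest hpk hki hk

lemma Consec.eq_of_mem {p q p' q' i : ℕ} (h : Consec C p q) (h' : Consec C p' q') (hp : p ≤ i)
    (hq : i < q) (hp' : p' ≤ i) (hq' : i < q') : p = p' ∧ q = q' := by
  obtain ⟨a1, a2, a3, a4⟩ := h
  obtain ⟨b1, b2, b3, b4⟩ := h'
  have c1 : p = p' := by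
    rcases lt_trichotomy p p' with h | h | h
    · have := a4 p' b1 h; omega
    · exact h
    · have := b4 p a1 h; omega
  subst c1
  exact ⟨rfl, le_antisymm (a4 q' b2 b3) (b4 q a2 a3)⟩

lemma IsCut.consec_le (hC : IsCut C lo hi) {p q : ℕ} (h : Consec C p q) : q ≤ p + hi := by
  obtain ⟨k, hk, h1, h2⟩ := hC.2.2 p
  exact (h.2.2.2 k hk h1).trans h2

lemma IsCut.le_consec (hC : IsCut C lo hi) {p q : ℕ} (h : Consec C p q) : p + lo ≤ q :=
  hC.2.1 p h.1 q h.2.1 h.2.2.1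

/-- Induction along the cut points. -/
lemma IsCut.induction (hC : IsCut C lo hi) {P : ℕ → Prop} {p : ℕ} (hp : p ∈ C) (h0 : P p)
    (hs : ∀ k q, p ≤ k → Consec C k q → P k → P q) : ∀ q ∈ C, p ≤ q → P q := by
  intro q
  induction q using Nat.strong_induction_on with
  | _ q ih =>
    intro hq hpq
    rcases hpq.eq_or_lt with rfl | hlt
    · exact h0
    obtain ⟨k, q', hc, hk, hq'⟩ := hC.exists_consec (q - 1)
    have hqq : q = q' := by
      have := hc.2.2.2 q hq (by omega)
      omega
    subst hqq
    have hpk : p ≤ k := by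
      by_contra! h
      have := hc.2.2.2 p hp h
      omega
    exact hs k q hpk hc (ih k (by omega) hc.1 hpk)

/-- Move every point of `ρ` to the next point of `C`. -/
lemma IsCut.align {ρ : Set ℕ} {R L : ℕ} {w : ℕ → B} (hC : IsCut C lo R) (hρ : IsCut ρ (L + R) (2 * (L + R)))
    (hCw : Factor (fun i => i ∈ C) w) (hρw : Factor (fun i => i ∈ ρ) w) :
    ∃ C₁ ⊆ C, IsCut C₁ L (2 * L + 3 * R) ∧ Factor (fun i => i ∈ C₁) w := by
  classical
  -- Points move forward by at most `R`. Hence spacing `L + R` leaves at least `L`, and gaps of `2 *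
  -- (L + R)` grow to at most `2 * L + 3 * R`.
  have hlt : ∀ p q, q ∈ C → p ≤ q → (∀ r ∈ C, p ≤ r → q ≤ r) → q ≤ p + R := by
    intro p q hq hpq hmin
    obtain ⟨r, hr, h1, h2⟩ := hC.2.2 p
    exact (hmin r hr h1.le).trans h2
  refine ⟨{q | q ∈ C ∧ ∃ p ∈ ρ, p ≤ q ∧ ∀ r ∈ C, p ≤ r → q ≤ r}, fun q hq => hq.1, ⟨?_, ?_, ?_⟩, ?_⟩
  · exact ⟨hC.1, 0, hρ.1, le_rfl, fun r _ h => h⟩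
  · rintro q ⟨hq, p, hp, hpq, hmin⟩ q' ⟨hq', p', hp', hpq', hmin'⟩ hqq
    have h1 := hlt p q hq hpq hmin
    rcases lt_or_ge p p' with h | h
    · have := hρ.2.1 p hp p' hp' h
      omega
    · have := hmin' q hq (by omega)
      omega
  · intro i
    obtain ⟨p, hp, h1, h2⟩ := hρ.2.2 i
    have hex : ∃ q, q ∈ C ∧ p ≤ q := by
      obtain ⟨r, hr, h3, -⟩ := hC.2.2 p
      exact ⟨r, hr, h3.le⟩
    have hq := Nat.find_spec hex
    have hmin : ∀ r ∈ C, p ≤ r → Nat.find hex ≤ r := fun r hr hpr => Nat.find_min' hex ⟨hr, hpr⟩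
    have := hlt p _ hq.1 hq.2 hmin
    exact ⟨_, ⟨hq.1, p, hp, hq.2, hmin⟩, by omega, by omega⟩
  · refine LocalTo.factor_trans (v := fun i => (i ∈ C, i ∈ ρ)) ⟨R, fun i j hi hj hw => ?_⟩
      (hCw.prodMk hρw)
    have key : ∀ i j, R ≤ i → R ≤ j → (∀ t ≤ 2 * R, (i - R + t ∈ C, i - R + t ∈ ρ)
        = (j - R + t ∈ C, j - R + t ∈ ρ)) → (i ∈ C ∧ ∃ p ∈ ρ, p ≤ i ∧ ∀ r ∈ C, p ≤ r → i ≤ r) →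
        (j ∈ C ∧ ∃ p ∈ ρ, p ≤ j ∧ ∀ r ∈ C, p ≤ r → j ≤ r) := by
      rintro i j hi hj hw ⟨hiC, p, hp, hpi, hmin⟩
      have h1 := hlt p i hiC hpi hmin
      have hw1 : ∀ t ≤ 2 * R, (i - R + t ∈ C ↔ j - R + t ∈ C) := fun t ht =>
        iff_of_eq (congrArg Prod.fst (hw t ht))
      have hw2 : ∀ t ≤ 2 * R, (i - R + t ∈ ρ ↔ j - R + t ∈ ρ) := fun t ht =>
        iff_of_eq (congrArg Prod.snd (hw t ht))
      refine ⟨?_, j - (i - p), ?_, by omega, fun r hr hpr => ?_⟩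
      · have := hw1 R (by omega)
        rwa [Nat.sub_add_cancel hi, Nat.sub_add_cancel hj, iff_true_left hiC] at this
      · have := hw2 (R - (i - p)) (by omega)
        rwa [show i - R + (R - (i - p)) = p by omega, iff_true_left hp,
          show j - R + (R - (i - p)) = j - (i - p) by omega] at this
      · by_contra! hrj
        have := hw1 (R - (j - r)) (by omega)
        rw [show j - R + (R - (j - r)) = r by omega, iff_true_right hr] at this
        have := hmin _ this (by omega)
        omega
    exact propext ⟨key i j hi hj hw, key j i hj hi fun t ht => (hw t ht).symm⟩

/-- Remove the cut points strictly between `0` and `n`. -/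
lemma IsCut.merge {n : ℕ} (hC : IsCut C lo hi) (hn : n ∈ C) :
    IsCut {q | q ∈ C ∧ (q = 0 ∨ n ≤ q)} lo (n + hi) := by
  refine ⟨⟨hC.1, Or.inl rfl⟩, fun p hp q hq => hC.2.1 p hp.1 q hq.1, fun i => ?_⟩
  rcases lt_or_ge i n with h | h
  · exact ⟨n, ⟨hn, Or.inr le_rfl⟩, h, by omega⟩
  · obtain ⟨q, hq, h1, h2⟩ := hC.2.2 i
    exact ⟨q, ⟨hq, Or.inr (by omega)⟩, h1, by omega⟩

/-- Replace all blocks between consecutive cut points by words of the same length. -/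
lemma IsCut.exists_replace (hC : IsCut C lo hi) (y : ℕ → A) (f : List A → List A)
    (hf : ∀ p q, Consec C p q → (f (word y p (q - p))).length = q - p) :
    ∃ y' : ℕ → A, (∀ p q, Consec C p q → word y' p (q - p) = f (word y p (q - p))) ∧
      LocalTo y' (fun i => (y i, i ∈ C)) := by
  classical
  choose P Q hPQ hP hQ using hC.exists_consec
  -- As `f` preserves the lengths of blocks, the default value is never used. The block of `i` lies
  -- within distance `hi` of `i`, which gives the coding radius.
  let y' : ℕ → A := fun i => ((f (word y (P i) (Q i - P i)))[i - P i]?).getD (y 0)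
  refine ⟨y', fun p q hpq => ?_, hi, fun i j hi' hj hw => ?_⟩
  · refine List.ext_getElem? fun t => ?_
    rcases lt_or_ge t (q - p) with ht | ht
    · rw [word_getElem? _ _ ht]
      obtain ⟨e1, e2⟩ := hpq.eq_of_mem (hPQ (p + t)) (by omega) (by omega) (hP _) (hQ _)
      simp only [y']
      rw [← e1, ← e2, Nat.add_sub_cancel_left, List.getElem?_eq_getElem (by rw [hf p q hpq]; exact ht)]
      rfl
    · rw [List.getElem?_eq_none (by simpa using ht),
        List.getElem?_eq_none (by rw [hf p q hpq]; exact ht)]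
  · have hw1 : ∀ t ≤ 2 * hi, (i - hi + t ∈ C ↔ j - hi + t ∈ C) := fun t ht =>
      iff_of_eq (congrArg Prod.snd (hw t ht))
    have hw2 : ∀ t ≤ 2 * hi, y (i - hi + t) = y (j - hi + t) := fun t ht =>
      congrArg Prod.fst (hw t ht)
    have hgap := hC.consec_le (hPQ i)
    have h1 := hP i
    have h2 := hQ i
    obtain ⟨c1, c2, c3, c4⟩ := hPQ i
    have hcon : Consec C (j - (i - P i)) (j + (Q i - i)) := by
      refine ⟨?_, ?_, by omega, fun k hk hlt => ?_⟩
      · have := hw1 (hi - (i - P i)) (by omega)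
        rwa [show i - hi + (hi - (i - P i)) = P i by omega, iff_true_left c1,
          show j - hi + (hi - (i - P i)) = j - (i - P i) by omega] at this
      · have := hw1 (hi + (Q i - i)) (by omega)
        rwa [show i - hi + (hi + (Q i - i)) = Q i by omega, iff_true_left c2,
          show j - hi + (hi + (Q i - i)) = j + (Q i - i) by omega] at this
      · by_contra! hkq
        have := hw1 (k + hi - j) (by omega)
        rw [show j - hi + (k + hi - j) = k by omega, iff_true_right hk] at this
        have := c4 _ this (by omega)
        omega
    obtain ⟨e1, e2⟩ := hcon.eq_of_mem (hPQ j) (i := j) (by omega) (by omega) (hP _) (hQ _)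
    have ew : word y (P i) (Q i - P i) = word y (P j) (Q j - P j) := by
      rw [show Q j - P j = Q i - P i by omega, word_eq_word_iff]
      intro t ht
      have := hw2 (hi - (i - P i) + t) (by omega)
      rwa [show i - hi + (hi - (i - P i) + t) = P i + t by omega,
        show j - hi + (hi - (i - P i) + t) = P j + t by omega] at this
    simp only [y']
    rw [ew, show i - P i = j - P j by omega]

end Cuts

/-! ### One refinement step of the block construction -/

section Refinement

open scoped Computability

variable {A B : Type*}

lemma mem_kstar_of_mem {𝒢 : Language A} {v : List A} (h : v ∈ 𝒢) : v ∈ 𝒢∗ :=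
  Language.mem_kstar.2 ⟨[v], by simp, by simpa using h⟩

lemma append_mem_kstar {𝒢 : Language A} {v₁ v₂ : List A} (h₁ : v₁ ∈ 𝒢∗) (h₂ : v₂ ∈ 𝒢∗) :
    v₁ ++ v₂ ∈ 𝒢∗ := by
  rw [← kstar_mul_kstar]
  exact Language.append_mem_mul h₁ h₂

/-- The sequence `y` is divided by `C` into blocks from `𝒢`, all of it is coded by `w`, and the
words in `𝒢` can be combined to words of all large lengths. -/
structure BlockStage (w : ℕ → B) (y : ℕ → A) (C : Set ℕ) (𝒢 : Language A) (R s : ℕ) : Prop where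
  factor : Factor (fun i => (y i, i ∈ C)) w
  cut : IsCut C 1 R
  block : ∀ p q, Consec C p q → word y p (q - p) ∈ 𝒢
  flex : ∀ m, s ≤ m → ∃ v ∈ 𝒢∗, v.length = m

lemma BlockStage.word_mem {w : ℕ → B} {y : ℕ → A} {C : Set ℕ} {𝒢 : Language A} {R s : ℕ}
    (h : BlockStage w y C 𝒢 R s) {p q : ℕ} (hp : p ∈ C) (hq : q ∈ C) (hpq : p ≤ q) :
    word y p (q - p) ∈ 𝒢∗ := by
  refine h.cut.induction (P := fun q => word y p (q - p) ∈ 𝒢∗) hp ?_ ?_ q hq hpq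
  · rw [Nat.sub_self]
    exact Language.nil_mem_kstar _
  · intro k q hpk hkq ih
    have := hkq.2.2.1
    rw [show q - p = (k - p) + (q - k) by omega, word_add, show p + (k - p) = k by omega]
    exact append_mem_kstar ih (mem_kstar_of_mem (h.block k q hkq))

/-- The occurrences of a word in a factor of `w` form a set approximately coded by `w`, so `ErgSeq`
applies to it. For finitely many words one window length serves all, each taking a share of `ε`. -/
lemma exists_typical_windows {w : ℕ → B} {y : ℕ → A} (hw : ErgSeq w) (hy : Factor y w)
    (U : Finset (List A)) {ε : ℝ} (hε : 0 < ε) : ∃ c : List A → ℝ, ∃ N, 1 ≤ N ∧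
      ∀ᶠ n : ℕ in atTop, ∑ i ∈ range n, ∑ u ∈ U,
        |mavg (fun i => ind (word y i u.length = u)) N i - c u| ≤ ε * n := by
  have hu : ∀ u : List A, ErgMean (fun i => ind (word y i u.length = u)) := by
    intro u
    refine (LocalTo.factor_trans (u := fun i => word y i u.length = u) ?_ hy).ergMean hw
    refine ⟨u.length, fun i j hi hj h => ?_⟩
    have : word y i u.length = word y j u.length := word_eq_word_iff.2 fun t ht => by
      have := h (u.length + t) (by omega)
      rwa [show i - u.length + (u.length + t) = i + t by omega,
        show j - u.length + (u.length + t) = j + t by omega] at this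
    simp only [this]
  choose c hc using fun u => hu u (ε / (U.card + 1)) (by positivity)
  have hall : ∀ᶠ N in atTop, ∀ u ∈ U, ∀ᶠ n : ℕ in atTop, ∑ i ∈ range n,
      |mavg (fun i => ind (word y i u.length = u)) N i - c u| ≤ ε / (U.card + 1) * n :=
    (Filter.eventually_all_finset U).2 fun u _ => hc u
  obtain ⟨N, hN, hN1⟩ := (hall.and (eventually_ge_atTop 1)).exists
  refine ⟨c, N, hN1, ?_⟩
  filter_upwards [(Filter.eventually_all_finset U).2 hN] with n hn
  rw [Finset.sum_comm]
  calc _ ≤ ∑ u ∈ U, ε / (U.card + 1) * n := Finset.sum_le_sum hn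
    _ = U.card / (U.card + 1 : ℝ) * (ε * n) := by
        rw [Finset.sum_const, nsmul_eq_mul]; ring
    _ ≤ 1 * (ε * n) := by
        gcongr
        rw [div_le_one (by positivity)]
        linarith
    _ = ε * n := one_mul _

/-- The words composed of words from `𝒢` with length in `[lo, hi]`, containing `pre`, and with
typical frequencies of the words in `U`. -/
def goodLang (𝒢 : Language A) (U : Finset (List A)) (c : List A → ℝ) (δ : ℝ) (lo hi : ℕ)
    (pre : List A) : Language A :=
  {v | v ∈ 𝒢∗ ∧ lo ≤ v.length ∧ v.length ≤ hi ∧ pre <:+: v ∧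
    ∀ u ∈ U, |occ u v - c u * v.length| ≤ δ * v.length}

/-- A head changes the count of `u` by at most its length and the expected count by `|c u|` times
its length. Short heads thus keep a typical word typical. -/
lemma append_mem_goodLang {𝒢 : Language A} {U : Finset (List A)} {c : List A → ℝ} {δ : ℝ}
    {lo hi : ℕ} {pre h t : List A} (hh : h ∈ 𝒢∗) (ht : t ∈ 𝒢∗) (hpre : pre <:+: h)
    (h1 : lo ≤ (h ++ t).length) (h2 : (h ++ t).length ≤ hi)
    (hu : ∀ u ∈ U, |occ u t - c u * t.length| + (1 + |c u|) * h.length ≤ δ * (h ++ t).length) :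
    h ++ t ∈ goodLang 𝒢 U c δ lo hi pre := by
  refine ⟨append_mem_kstar hh ht, h1, h2, hpre.trans (List.infix_append' [] h t), fun u huU => ?_⟩
  refine le_trans ?_ (hu u huU)
  have e1 := occ_le_occ_append_left u h t
  have e2 := occ_append_le_length_add u h t
  have e3 : |occ u (h ++ t) - occ u t| ≤ h.length := by
    rw [abs_le]; constructor <;> linarith
  have e4 : occ u (h ++ t) - c u * (h ++ t).length = (occ u t - c u * t.length)
      + (occ u (h ++ t) - occ u t) + -(c u * h.length) := by
    rw [List.length_append]; push_cast; ring
  rw [e4]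
  have e5 := abs_add_three (occ u t - c u * t.length) (occ u (h ++ t) - occ u t)
    (-(c u * h.length))
  rw [abs_neg, abs_mul, Nat.abs_cast] at e5
  linarith

lemma abs_occ_word_sub_le (y : ℕ → A) (u : List A) (c : ℝ) {N : ℕ} (hN : 1 ≤ N) (p l : ℕ) :
    |occ u (word y p l) - c * l| ≤ ∑ j ∈ range l,
      |mavg (fun i => ind (word y i u.length = u)) N (p + j) - c| + (N + u.length) := by
  have h1 := abs_sum_sub_le (g := fun i => ind (word y i u.length = u)) (fun _ => ind_nonneg _)
    (fun _ => ind_le_one _) c hN p l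
  have h2 := occ_word_le y u p l
  have h3 := le_occ_word y u p l
  have h4 : (0 : ℝ) ≤ u.length := by positivity
  rw [abs_le] at *
  constructor <;> linarith

/-- One step of the construction: after a small modification, `y` is divided into blocks in which
the frequencies of the words from `U` are nearly constant. -/
theorem BlockStage.exists_refine {w : ℕ → B} {y : ℕ → A} {C : Set ℕ} {𝒢 : Language A} {R s : ℕ}
    (hw : ErgSeq w)
    (hmark : ∀ L : ℕ, 1 ≤ L → ∃ ρ : Set ℕ, IsCut ρ L (2 * L) ∧ Factor (fun i => i ∈ ρ) w)
    (h : BlockStage w y C 𝒢 R s) (U : Finset (List A)) {δ ε : ℝ} (hδ : 0 < δ) (hε : 0 < ε)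
    (m₀ : ℕ) : ∃ (y' : ℕ → A) (C' : Set ℕ) (𝒢' : Language A) (R' s' n₀ : ℕ),
      BlockStage w y' C' 𝒢' R' s' ∧ m₀ ≤ n₀ ∧ (∀ i < n₀, y' i = y i) ∧ word y' 0 n₀ ∈ 𝒢' ∧
      (∀ n : ℕ, ∑ i ∈ range n, ind (y i ≠ y' i) ≤ ε * n) ∧
      (∀ v ∈ 𝒢', v ∈ 𝒢∗ ∧ m₀ ≤ v.length ∧ v.length ≤ R' ∧ word y 0 m₀ <:+: v) ∧
      ∀ u ∈ U, ∃ c : ℝ, ∀ v ∈ 𝒢', |occ u v - c * v.length| ≤ δ * v.length := by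
  classical
  have hyw : Factor y w := ((LocalTo.refl (fun i => (y i, i ∈ C))).comp Prod.fst).factor_trans
    h.factor
  have hCw : Factor (fun i => i ∈ C) w :=
    ((LocalTo.refl (fun i => (y i, i ∈ C))).comp Prod.snd).factor_trans h.factor
  set γ := δ / 2 with hγ
  have hγ0 : 0 < γ := by positivity
  have hδγ : ∀ x : ℝ, δ * x = γ * x + γ * x := fun x => by rw [hγ]; ring
  -- Blocks over which `e` averages more than `γ` will fill at most the fraction `ε₁ / γ ≤ ε / 4`.
  -- The bound `ε₁ ≤ γ` makes long initial words of `y` typical.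
  set ε₁ := γ * min (ε / 4) 1 with hε₁
  have hε₁0 : 0 < ε₁ := by positivity
  have hε₁γ : ε₁ ≤ γ := by
    rw [hε₁]; exact mul_le_of_le_one_right hγ0.le (min_le_right _ _)
  obtain ⟨c, N, hN, hwin⟩ := exists_typical_windows hw hyw U hε₁0
  set e : ℕ → ℝ := fun i => ∑ u ∈ U, |mavg (fun i => ind (word y i u.length = u)) N i - c u|
    with he
  have he0 : ∀ i, 0 ≤ e i := fun i => Finset.sum_nonneg fun _ _ => abs_nonneg _
  obtain ⟨n₁, hn₁⟩ := eventually_atTop.1 hwin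
  -- A head consists of the first `c₀` letters of `y`, which contain `word y 0 m₀` and end at a
  -- point of `C`, and of filler whose length must be at least `s`. A further `R` lets the remainder
  -- begin at a point of `C`, so heads of length at most `K` suffice.
  obtain ⟨c₀, hc₀, hmc₀, -⟩ := h.cut.2.2 m₀
  set K := c₀ + s + R with hK
  set X : ℝ := N + ∑ u ∈ U, (u.length + (1 + |c u|) * K) with hX
  have hXu : ∀ u ∈ U, N + u.length + (1 + |c u|) * K ≤ X := by
    intro u hu
    have := Finset.single_le_sum (f := fun u : List A => (u.length + (1 + |c u|) * K : ℝ))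
      (fun u _ => by positivity) hu
    linarith
  -- The blocks are so long that the errors of fixed size stay below the second half `γ` of the
  -- tolerance, that heads fill at most `ε / 4` of a block, and that what is left of a block without
  -- its head is longer than `n₁`.
  obtain ⟨L, hL1, hL2, hL3⟩ := ((eventually_const_le hγ0 X).and
    ((eventually_const_le (ε := ε / 4) (by positivity) K).and
      (eventually_ge_atTop (n₁ + K + m₀ + 1)))).exists
  obtain ⟨ρ, hρ, hρw⟩ := hmark (L + R) (by omega)
  obtain ⟨C₁, hC₁C, hC₁, hC₁w⟩ := h.cut.align hρ hCw hρw
  set G := 2 * L + 3 * R with hG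
  obtain ⟨n₀, hn₀, hn₀G, -⟩ := hC₁.2.2 (G + L)
  set C' : Set ℕ := {q | q ∈ C₁ ∧ (q = 0 ∨ n₀ ≤ q)} with hC'
  have hcut' : IsCut C' L (n₀ + G) := hC₁.merge hn₀
  have hC'C : C' ⊆ C := fun q hq => hC₁C hq.1
  have hC'w : Factor (fun i => i ∈ C') w := hC₁w.congr n₀ fun i hi =>
    propext ⟨fun h => ⟨h, Or.inr hi⟩, fun h => h.1⟩
  set R' := n₀ + G with hR'
  set 𝒢' := goodLang 𝒢 U c δ L R' (word y 0 m₀) with h𝒢'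
  -- heads and tails of good words
  have head : ∀ m, c₀ + s ≤ m → ∃ v ∈ 𝒢∗, v.length = m ∧ word y 0 m₀ <:+: v := by
    intro m hm
    obtain ⟨f, hf, hfl⟩ := h.flex (m - c₀) (by omega)
    refine ⟨word y 0 c₀ ++ f, append_mem_kstar ?_ hf, ?_, ?_⟩
    · simpa using h.word_mem h.cut.1 hc₀ (Nat.zero_le _)
    · rw [List.length_append, length_word, hfl]; omega
    · rw [show c₀ = m₀ + (c₀ - m₀) by omega, word_add, List.append_assoc]
      exact List.infix_append' [] _ _
  have est : ∀ p l, ∀ u ∈ U, |occ u (word y p l) - c u * l|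
      ≤ ∑ j ∈ range l, e (p + j) + (N + u.length) := by
    intro p l u hu
    refine (abs_occ_word_sub_le y u (c u) hN p l).trans ?_
    gcongr with j hj
    exact Finset.single_le_sum
      (f := fun u => |mavg (fun i => ind (word y i u.length = u)) N (p + j) - c u|)
      (fun _ _ => abs_nonneg _) hu
  have cand : ∀ d l m, word y d l ∈ 𝒢∗ → L ≤ m → m ≤ R' → l + (c₀ + s) ≤ m → m ≤ l + K →
      ∑ j ∈ range l, e (d + j) ≤ γ * m →
      ∃ v ∈ 𝒢', v.length = m ∧ v.drop (m - l) = word y d l := by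
    intro d l m hmem hLm hmR hl1 hl2 hsum
    obtain ⟨f, hf, hfl, hpre⟩ := head (m - l) (by omega)
    have hlen : (f ++ word y d l).length = m := by
      rw [List.length_append, length_word]; omega
    refine ⟨f ++ word y d l, append_mem_goodLang hf hmem hpre (by omega) (by omega)
      fun u hu => ?_, hlen, ?_⟩
    · have h1 := est d l u hu
      have h2 := hXu u hu
      have h3 : (1 + |c u|) * f.length ≤ (1 + |c u|) * K := by
        gcongr; omega
      have h4 : γ * L ≤ γ * m := by gcongr
      rw [hlen, length_word, hδγ]
      linarith
    · rw [← hfl]; exact List.drop_left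
  -- A head of suitable length is put before an initial word of `y` that ends at a point of `C` and
  -- is typical because it is longer than `n₁`.
  have alllen : ∀ m, L ≤ m → m ≤ R' → ∃ v ∈ 𝒢', v.length = m := by
    intro m hLm hmR
    obtain ⟨q, hq, hq1, hq2⟩ := h.cut.2.2 (m - K - 1)
    obtain ⟨v, hv, hvl, -⟩ := cand 0 q m
      (by simpa using h.word_mem h.cut.1 hq (Nat.zero_le _)) hLm hmR (by omega) (by omega) (by
        simp only [zero_add]
        calc _ ≤ ε₁ * q := hn₁ q (by omega)
          _ ≤ γ * m := by
            gcongr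
            omega)
    exact ⟨v, hv, hvl⟩
  -- The replacement depends on the word alone, so that it defines a block code. Good words are
  -- kept; otherwise the letters after the first `K` are kept if possible; otherwise any good word
  -- of the right length is taken.
  have repl : ∀ v : List A, ∃ v' : List A, L ≤ v.length → v.length ≤ R' →
      v' ∈ 𝒢' ∧ v'.length = v.length ∧ (v ∈ 𝒢' → v' = v) ∧
      ((∃ v' ∈ 𝒢', v'.length = v.length ∧ v'.drop K = v.drop K) → v'.drop K = v.drop K) := by
    intro v
    by_cases h1 : v ∈ 𝒢'
    · exact ⟨v, fun _ _ => ⟨h1, rfl, fun _ => rfl, fun _ => rfl⟩⟩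
    by_cases h2 : ∃ v' ∈ 𝒢', v'.length = v.length ∧ v'.drop K = v.drop K
    · obtain ⟨v', hv', hl, hd⟩ := h2
      exact ⟨v', fun _ _ => ⟨hv', hl, fun h => absurd h h1, fun _ => hd⟩⟩
    by_cases h3 : L ≤ v.length ∧ v.length ≤ R'
    · obtain ⟨v', hv', hl⟩ := alllen v.length h3.1 h3.2
      exact ⟨v', fun _ _ => ⟨hv', hl, fun h => absurd h h1, fun h => absurd h h2⟩⟩
    · exact ⟨v, fun a b => absurd ⟨a, b⟩ h3⟩
  choose f hf using repl
  have hlen : ∀ p q, Consec C' p q → L ≤ (word y p (q - p)).length ∧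
      (word y p (q - p)).length ≤ R' := by
    intro p q hpq
    have h1 := hcut'.le_consec hpq
    have h2 := hcut'.consec_le hpq
    rw [length_word]
    omega
  obtain ⟨y', hy', hy'loc⟩ := hcut'.exists_replace y f fun p q hpq => by
    rw [(hf _ (hlen p q hpq).1 (hlen p q hpq).2).2.1, length_word]
  have hcon0 : Consec C' 0 n₀ := by
    refine ⟨hcut'.1, ⟨hn₀, Or.inr le_rfl⟩, by omega, fun k hk h0 => ?_⟩
    rcases hk.2 with h | h <;> omega
  have hgood0 : word y 0 n₀ ∈ 𝒢' := by
    refine ⟨by simpa using h.word_mem h.cut.1 (hC₁C hn₀) (Nat.zero_le _), by simp; omega,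
      by simp [hR'], ?_, fun u hu => ?_⟩
    · rw [show n₀ = m₀ + (n₀ - m₀) by omega, word_add]
      exact List.infix_append' [] _ _
    · have h1 := est 0 n₀ u hu
      have h2 := hXu u hu
      have h3 : (0 : ℝ) ≤ (1 + |c u|) * K := by positivity
      have h4 := hn₁ n₀ (by omega)
      have h5 : γ * L ≤ γ * n₀ := by gcongr; omega
      have h6 : ε₁ * n₀ ≤ γ * n₀ := by gcongr
      simp only [zero_add] at h1
      rw [length_word, hδγ]
      linarith
  have hy'0 : word y' 0 n₀ = word y 0 n₀ := by
    have h1 := hy' 0 n₀ hcon0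
    have h2 := (hf _ (hlen 0 n₀ hcon0).1 (hlen 0 n₀ hcon0).2).2.2.1
    rw [Nat.sub_zero] at h1 h2
    rw [h1, h2 hgood0]
  have hagree : ∀ i < n₀, y' i = y i := by
    intro i hi
    have := word_eq_word_iff.1 hy'0 i hi
    simpa using this
  -- the changes in a block
  have change : ∀ p q, Consec C' p q → ∑ j ∈ range (q - p), ind (y (p + j) ≠ y' (p + j))
      ≤ ε / 4 * (q - p : ℕ) + 1 / γ * ∑ j ∈ range (q - p), e (p + j) := by
    intro p q hpq
    obtain ⟨hl1, hl2⟩ := hlen p q hpq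
    have hsum0 : 0 ≤ ∑ j ∈ range (q - p), e (p + j) := Finset.sum_nonneg fun _ _ => he0 _
    have hl1' := hl1
    have hl2' := hl2
    rw [length_word] at hl1' hl2'
    -- If the deviation is small, a new head before the part of the block from `d` on gives a good
    -- word, so at most `K` letters change. Otherwise the entire length is charged to the sum of
    -- `e`, at the rate `1 / γ`.
    by_cases hs : ∑ j ∈ range (q - p), e (p + j) ≤ γ * (q - p : ℕ)
    · obtain ⟨d, hd, hd1, hd2⟩ := h.cut.2.2 (p + (c₀ + s) - 1)
      have hex : ∃ v' ∈ 𝒢', v'.length = (word y p (q - p)).length ∧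
          v'.drop K = (word y p (q - p)).drop K := by
        obtain ⟨v', hv', hvl, hvd⟩ := cand d (q - d) (q - p)
          (h.word_mem hd (hC'C hpq.2.1) (by omega)) hl1' hl2' (by omega) (by omega) (by
            refine le_trans ?_ hs
            have := Finset.sum_range_add (fun j => e (p + j)) (d - p) (q - d)
            rw [show d - p + (q - d) = q - p by omega] at this
            rw [this]
            have e1 : ∀ j, p + (d - p + j) = d + j := fun j => by omega
            simp only [e1]
            have : 0 ≤ ∑ j ∈ range (d - p), e (p + j) := Finset.sum_nonneg fun _ _ => he0 _
            linarith)
        refine ⟨v', hv', by rw [hvl, length_word], ?_⟩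
        rw [show K = (q - p - (q - d)) + (K - (d - p)) by omega, ← List.drop_drop, hvd, word_drop,
          word_drop, show p + (q - p - (q - d) + (K - (d - p))) = d + (K - (d - p)) by omega,
          show q - p - (q - p - (q - d) + (K - (d - p))) = q - d - (K - (d - p)) by omega]
      have hdrop := (hf _ hl1 hl2).2.2.2 hex
      rw [← hy' p q hpq, word_drop, word_drop, word_eq_word_iff] at hdrop
      calc _ ≤ ∑ j ∈ range (q - p), ind (j < K) := by
            refine Finset.sum_le_sum fun j hj => ind_mono fun hne => ?_
            have hj := Finset.mem_range.1 hj
            by_contra! hKj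
            have := hdrop (j - K) (by omega)
            rw [show p + K + (j - K) = p + j by omega] at this
            exact hne this.symm
        _ ≤ K := sum_ind_lt_le _ _
        _ ≤ ε / 4 * L := hL2
        _ ≤ ε / 4 * (q - p : ℕ) := by gcongr
        _ ≤ _ := by
            have : 0 ≤ 1 / γ * ∑ j ∈ range (q - p), e (p + j) := by positivity
            linarith
    · push Not at hs
      calc _ ≤ ∑ j ∈ range (q - p), (1 : ℝ) := Finset.sum_le_sum fun _ _ => ind_le_one _
        _ = 1 / γ * (γ * (q - p : ℕ)) := by
            rw [one_div, inv_mul_cancel_left₀ hγ0.ne']; simp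
        _ ≤ 1 / γ * ∑ j ∈ range (q - p), e (p + j) := by gcongr
        _ ≤ _ := by
            have : 0 ≤ ε / 4 * (q - p : ℕ) := by positivity
            linarith
  have changes : ∀ q ∈ C', ∑ i ∈ range q, ind (y i ≠ y' i)
      ≤ ε / 4 * q + 1 / γ * ∑ i ∈ range q, e i := by
    intro q hq
    refine hcut'.induction (P := fun q : ℕ => ∑ i ∈ range q, ind (y i ≠ y' i)
      ≤ ε / 4 * q + 1 / γ * ∑ i ∈ range q, e i) hcut'.1 (by simp) ?_ q hq (Nat.zero_le _)
    intro k q _ hkq ih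
    have h1 := change k q hkq
    obtain ⟨l, rfl⟩ := Nat.exists_eq_add_of_lt hkq.2.2.1
    rw [show k + l + 1 - k = l + 1 by omega] at h1
    have h2 := Finset.sum_range_add (fun i => ind (y i ≠ y' i)) k (l + 1)
    have h3 := Finset.sum_range_add e k (l + 1)
    rw [add_assoc, h2, h3]
    push_cast at h1 ⊢
    linarith
  refine ⟨y', C', 𝒢', R', L, n₀, ⟨?_, ⟨hcut'.1, fun p hp q hq hpq => hpq, hcut'.2.2⟩, ?_, ?_⟩,
    by omega, hagree, hy'0 ▸ hgood0, ?_, ?_, ?_⟩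
  · exact (hy'loc.factor_trans (hyw.prodMk hC'w)).prodMk hC'w
  · intro p q hpq
    rw [hy' p q hpq]
    exact (hf _ (hlen p q hpq).1 (hlen p q hpq).2).1
  · intro m
    induction m using Nat.strong_induction_on with
    | _ m ih =>
      intro hLm
      rcases le_or_gt m R' with hm | hm
      · obtain ⟨v, hv, hvl⟩ := alllen m hLm hm
        exact ⟨v, mem_kstar_of_mem hv, hvl⟩
      · obtain ⟨v₁, hv₁, hl₁⟩ := ih (m - L) (by omega) (by omega)
        obtain ⟨v₂, hv₂, hl₂⟩ := alllen L le_rfl (by omega)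
        exact ⟨v₁ ++ v₂, append_mem_kstar hv₁ (mem_kstar_of_mem hv₂), by
          rw [List.length_append]; omega⟩
  · intro n
    rcases le_or_gt n n₀ with hn | hn
    · rw [Finset.sum_eq_zero]
      · positivity
      · intro i hi
        have hi := Finset.mem_range.1 hi
        exact ind_of_not (not_not.2 (hagree i (by omega)).symm)
    · obtain ⟨q, hq, hq1, hq2⟩ := hC₁.2.2 n
      have h1 := changes q ⟨hq, Or.inr (by omega)⟩
      have h2 := hn₁ q (by omega)
      have h3 : (q : ℝ) ≤ 2 * n := by
        have : q ≤ 2 * n := by omega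
        exact_mod_cast this
      calc _ ≤ ∑ i ∈ range q, ind (y i ≠ y' i) := Finset.sum_le_sum_of_subset_of_nonneg
            (Finset.range_subset_range.2 hq1.le) fun _ _ _ => ind_nonneg _
        _ ≤ ε / 4 * q + 1 / γ * ∑ i ∈ range q, e i := h1
        _ ≤ ε / 4 * q + 1 / γ * (ε₁ * q) := by gcongr
        _ = ε / 4 * q + min (ε / 4) 1 * q := by rw [hε₁]; field_simp
        _ ≤ ε / 4 * q + ε / 4 * q := by gcongr; exact min_le_left _ _
        _ = ε / 2 * q := by ring
        _ ≤ ε / 2 * (2 * n) := by gcongr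
        _ = ε * n := by ring
  · rintro v ⟨hv1, hv2, hv3, hv4, -⟩
    exact ⟨hv1, by omega, hv3, hv4⟩
  · intro u hu
    exact ⟨c u, fun v hv => hv.2.2.2.2 u hu⟩

end Refinement

/-! ### The limit sequence: uniform frequencies and recurrence -/

section Uniform

open scoped Computability

variable {A : Type*}

/-- All words have uniform frequencies in `z`. -/
def UniformFreq (z : ℕ → A) : Prop :=
  ∀ u : List A, ∀ δ > 0, ∃ c : ℝ, ∃ l₀ : ℕ, ∀ l, l₀ ≤ l → ∀ i,
    |∑ j ∈ range l, ind (word z (i + j) u.length = u) - c * l| ≤ δ * l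

/-- All initial words of `z` recur with bounded gaps. -/
def UniformRec (z : ℕ → A) : Prop :=
  ∀ m, ∃ R : ℕ, ∀ i, ∃ j ≤ R, word z (i + j) m = word z 0 m

lemma kstar_subset {𝒢 ℋ : Language A} (h : ∀ v ∈ 𝒢, v ∈ ℋ∗) {v : List A} (hv : v ∈ 𝒢∗) :
    v ∈ ℋ∗ := by
  obtain ⟨L, rfl, hL⟩ := Language.mem_kstar.1 hv
  clear hv
  induction L with
  | nil => exact Language.nil_mem_kstar _
  | cons a L ih =>
    rw [List.flatten_cons]
    exact append_mem_kstar (h a (hL a (by simp))) (ih fun b hb => hL b (by simp [hb]))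

/-- The piece `b` is the factor in which the place `t` falls, or empty if there are no factors. -/
lemma kstar_split {𝒢 : Language A} {R : ℕ} (h𝒢 : ∀ v ∈ 𝒢, v.length ≤ R) {v : List A}
    (hv : v ∈ 𝒢∗) {t : ℕ} (ht : t ≤ v.length) : ∃ v₁ b v₂, v₁ ∈ 𝒢∗ ∧ v₂ ∈ 𝒢∗ ∧
      v = v₁ ++ b ++ v₂ ∧ b.length ≤ R ∧ v₁.length ≤ t ∧ t ≤ (v₁ ++ b).length := by
  obtain ⟨L, rfl, hL⟩ := Language.mem_kstar.1 hv
  clear hv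
  induction L generalizing t with
  | nil =>
    exact ⟨[], [], [], Language.nil_mem_kstar _, Language.nil_mem_kstar _, by simp, by simp,
      by simp, by simpa using ht⟩
  | cons a L ih =>
    have hL' : ∀ b ∈ L, b ∈ 𝒢 := fun b hb => hL b (by simp [hb])
    rw [List.flatten_cons] at ht ⊢
    rcases le_total t a.length with h | h
    · exact ⟨[], a, L.flatten, Language.nil_mem_kstar _, Language.join_mem_kstar hL', by simp,
        h𝒢 a (hL a (by simp)), by simp, by simpa using h⟩
    · rw [List.length_append] at ht
      obtain ⟨v₁, b, v₂, h1, h2, h3, h4, h5, h6⟩ := ih (t := t - a.length) hL' (by omega)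
      refine ⟨a ++ v₁, b, v₂, append_mem_kstar (mem_kstar_of_mem (hL a (by simp))) h1, h2, ?_, h4,
        ?_, ?_⟩
      · rw [h3]; simp
      · rw [List.length_append]; omega
      · rw [List.append_assoc, List.length_append]; omega

/-- The errors of the blocks add up, and each junction creates at most `u.length` further
occurrences, charged to a neighbouring block at the rate `κ`. -/
lemma abs_occ_kstar_le {𝒢 : Language A} {u : List A} {c δ κ : ℝ}
    (h : ∀ v ∈ 𝒢, |occ u v - c * v.length| ≤ δ * v.length)
    (hu : ∀ v ∈ 𝒢, u.length ≤ κ * v.length) {v : List A} (hv : v ∈ 𝒢∗) :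
    |occ u v - c * v.length| ≤ (δ + κ) * v.length := by
  obtain ⟨L, rfl, hL⟩ := Language.mem_kstar.1 hv
  clear hv
  induction L with
  | nil => simp [occ]
  | cons a L ih =>
    rw [List.flatten_cons]
    have h1 := ih fun b hb => hL b (by simp [hb])
    have h2 := h a (hL a (by simp))
    have h3 := hu a (hL a (by simp))
    have h4 := occ_add_occ_le u a L.flatten
    have h5 := occ_append_le u a L.flatten
    have h6 : (0 : ℝ) ≤ u.length := by positivity
    rw [List.length_append]
    push_cast
    rw [abs_le] at *
    constructor <;> linarith

lemma word_eq_append {z : ℕ → A} {p n : ℕ} {v₁ v₂ : List A} (h : word z p n = v₁ ++ v₂) :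
    word z p v₁.length = v₁ ∧ word z (p + v₁.length) v₂.length = v₂ := by
  have hl : n = v₁.length + v₂.length := by simpa using congrArg List.length h
  rw [hl, word_add] at h
  exact List.append_inj h (by simp)

/-- Long windows consist of a concatenation of complete blocks and two short pieces. -/
lemma exists_core {𝒢 : Language A} {R : ℕ} (h𝒢 : ∀ v ∈ 𝒢, v.length ≤ R) {z : ℕ → A} {n i l : ℕ}
    (hz : word z 0 n ∈ 𝒢∗) (hn : i + l ≤ n) (hl : R < l) : ∃ a l', i ≤ a ∧ a ≤ i + R ∧
      a + l' ≤ i + l ∧ i + l ≤ a + l' + R ∧ word z a l' ∈ 𝒢∗ := by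
  obtain ⟨v₁, b, v₂, -, h2, h3, h4, h5, h6⟩ := kstar_split h𝒢 hz (t := i) (by simp; omega)
  have e1 := (word_eq_append h3).2
  rw [zero_add] at e1
  have hlen := congrArg List.length h3
  simp only [length_word, List.length_append] at hlen h6 e1
  obtain ⟨v₃, b', v₄, g1, -, g3, g4, g5, g6⟩ := kstar_split h𝒢 h2
    (t := i + l - (v₁.length + b.length)) (by omega)
  rw [g3, List.append_assoc] at e1
  have e2 := (word_eq_append e1).1
  simp only [List.length_append] at g6
  refine ⟨v₁.length + b.length, v₃.length, by omega, by omega, by omega, by omega, ?_⟩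
  rw [e2]
  exact g1

lemma exists_of_infix_word {z : ℕ → A} {p n : ℕ} {u : List A} (h : u <:+: word z p n) :
    ∃ j, j + u.length ≤ n ∧ word z (p + j) u.length = u := by
  obtain ⟨s, t, h⟩ := h
  have e1 := (word_eq_append h.symm).1
  have hl : s.length + u.length + t.length = n := by simpa [add_assoc] using congrArg List.length h
  exact ⟨s.length, by omega, (word_eq_append e1).2⟩

/-- The core of complete blocks from `exists_core` satisfies `abs_occ_kstar_le`; the two end pieces
have length at most `R` each and cause only a bounded error. -/
lemma abs_count_sub_le {𝒢 : Language A} {R : ℕ} (h𝒢 : ∀ v ∈ 𝒢, v.length ≤ R) {u : List A}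
    {c δ κ : ℝ} (h : ∀ v ∈ 𝒢, |occ u v - c * v.length| ≤ δ * v.length)
    (hu : ∀ v ∈ 𝒢, u.length ≤ κ * v.length) (hδκ : 0 ≤ δ + κ) {z : ℕ → A} {n i l : ℕ}
    (hz : word z 0 n ∈ 𝒢∗) (hn : i + l ≤ n) (hl : R < l) :
    |∑ j ∈ range l, ind (word z (i + j) u.length = u) - c * l|
      ≤ (δ + κ) * l + (u.length + 2 * R + |c| * (2 * R)) := by
  obtain ⟨a, l', h1, h2, h3, h4, h5⟩ := exists_core h𝒢 hz hn hl
  have b1 := abs_occ_kstar_le h hu h5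
  have b2 := occ_word_le z u a l'
  have b3 := le_occ_word z u a l'
  rw [length_word] at b1
  obtain ⟨x, rfl⟩ := Nat.exists_eq_add_of_le h1
  obtain ⟨y, hy⟩ := Nat.exists_eq_add_of_le (show x + l' ≤ l by omega)
  have e1 := Finset.sum_range_add (fun j => ind (word z (i + j) u.length = u)) (x + l') y
  have e2 := Finset.sum_range_add (fun j => ind (word z (i + j) u.length = u)) x l'
  rw [← hy] at e1
  rw [e2] at e1
  simp only [← add_assoc] at e1
  have c1 : ∀ q s : ℕ, ∑ t ∈ range s, ind (word z (q + t) u.length = u) ≤ s := fun q s => by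
    calc _ ≤ ∑ t ∈ range s, (1 : ℝ) := Finset.sum_le_sum fun i _ => ind_le_one _
      _ = s := by simp
  have c0 : ∀ q s : ℕ, 0 ≤ ∑ t ∈ range s, ind (word z (q + t) u.length = u) := fun q s =>
    Finset.sum_nonneg fun _ _ => ind_nonneg _
  have d1 := c1 i x
  have d2 := c1 (i + x + l') y
  have d3 := c0 i x
  have d4 := c0 (i + x + l') y
  have hx : (x : ℝ) ≤ R := by exact_mod_cast (by omega : x ≤ R)
  have hyR : (y : ℝ) ≤ R := by exact_mod_cast (by omega : y ≤ R)
  have hll : (l' : ℝ) ≤ l := by exact_mod_cast (by omega : l' ≤ l)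
  have hl2 : (l : ℝ) = l' + (x + y) := by rw [hy]; push_cast; ring
  have m1 : (δ + κ) * l' ≤ (δ + κ) * l := by gcongr
  have m2 : |c * (x + y : ℝ)| ≤ |c| * (2 * R) := by
    rw [abs_mul, abs_of_nonneg (by positivity : (0 : ℝ) ≤ x + y)]
    gcongr
    linarith
  have m3 : c * (l : ℝ) = c * l' + c * (x + y) := by rw [hl2]; ring
  have hu0 : (0 : ℝ) ≤ u.length := by positivity
  rw [e1, m3]
  rw [abs_le] at *
  constructor <;> linarith

/-- A sequence with the ergodic property can be approximated in density by sequences with uniform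
frequencies and uniform recurrence. -/
theorem ErgSeq.exists_uniform [Finite A] {y : ℕ → A} (hy : ErgSeq y) {ε : ℝ} (hε : 0 < ε) :
    ∃ z : ℕ → A, UniformFreq z ∧ UniformRec z ∧
      ∀ n : ℕ, ∑ i ∈ range n, ind (y i ≠ z i) ≤ ε * n := by
  classical
  obtain ⟨b, hw, hnorm⟩ := exists_relatively_normal hy
  set w := fun i => (y i, b i)
  have hmark : ∀ L : ℕ, 1 ≤ L → ∃ ρ : Set ℕ, IsCut ρ L (2 * L) ∧ Factor (fun i => i ∈ ρ) w :=
    fun L hL => exists_markers ((LocalTo.refl w).comp Prod.snd) hnorm hL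
  -- A state records the sequence, the cut set, the language of blocks, the bounds `R` and `s`, and
  -- the length of the frozen initial segment. It starts from single letters as blocks.
  let σ := (ℕ → A) × Set ℕ × Language A × ℕ × ℕ × ℕ
  let P : σ → Prop := fun t => BlockStage w t.1 t.2.1 t.2.2.1 t.2.2.2.1 t.2.2.2.2.1
  let U : ℕ → Finset (List A) := fun k => (List.finite_length_le A k).toFinset
  have step : ∀ (k : ℕ) (t : {t : σ // P t}), ∃ t' : {t : σ // P t},
      t.1.2.2.2.2.2 + (k + 1) ^ 2 ≤ t'.1.2.2.2.2.2 ∧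
      (∀ i < t'.1.2.2.2.2.2, t'.1.1 i = t.1.1 i) ∧ word t'.1.1 0 t'.1.2.2.2.2.2 ∈ t'.1.2.2.1 ∧
      (∀ n : ℕ, ∑ i ∈ range n, ind (t.1.1 i ≠ t'.1.1 i) ≤ ε * (1 / 2) ^ (k + 1) * n) ∧
      (∀ v ∈ t'.1.2.2.1, v ∈ t.1.2.2.1∗ ∧ t.1.2.2.2.2.2 + (k + 1) ^ 2 ≤ v.length ∧
        v.length ≤ t'.1.2.2.2.1 ∧ word t.1.1 0 (t.1.2.2.2.2.2 + (k + 1) ^ 2) <:+: v) ∧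
      ∀ u ∈ U k, ∃ c : ℝ, ∀ v ∈ t'.1.2.2.1, |occ u v - c * v.length| ≤ 1 / (k + 1) * v.length := by
    rintro k ⟨⟨Y, C, 𝒢, R, s, n⟩, ht⟩
    obtain ⟨Y', C', 𝒢', R', s', n', hst, h⟩ := BlockStage.exists_refine hw hmark ht (U k)
      (δ := 1 / (k + 1)) (ε := ε * (1 / 2) ^ (k + 1)) (by positivity) (by positivity)
      (n + (k + 1) ^ 2)
    exact ⟨⟨⟨Y', C', 𝒢', R', s', n'⟩, hst⟩, h⟩
  have h0 : P (y, Set.univ, {v | v.length = 1}, 1, 0, 0) := by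
    refine ⟨LocalTo.factor ?_, ⟨Set.mem_univ _, fun p _ q _ h => h, fun i => ⟨i + 1, Set.mem_univ _,
      by omega, le_rfl⟩⟩, fun p q hpq => ?_, fun m _ => ?_⟩
    · exact (LocalTo.refl w).comp fun a => (a.1, True)
    · have h1 := hpq.2.2.2 (p + 1) (Set.mem_univ _) (by omega)
      have h2 := hpq.2.2.1
      change (word y p (q - p)).length = 1
      rw [length_word]
      omega
    · refine ⟨List.replicate m (y 0), ?_, by simp⟩
      induction m with
      | zero => exact Language.nil_mem_kstar _
      | succ m ih =>
        have : List.replicate (m + 1) (y 0) = [y 0] ++ List.replicate m (y 0) := rfl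
        rw [this]
        exact append_mem_kstar (mem_kstar_of_mem rfl) (ih (Nat.zero_le _))
  choose next hnext using step
  let st : ℕ → {t : σ // P t} := fun k => Nat.rec ⟨_, h0⟩ next k
  have hst : ∀ k, st (k + 1) = next k (st k) := fun _ => rfl
  let Y : ℕ → ℕ → A := fun k => (st k).1.1
  let 𝒢 : ℕ → Language A := fun k => (st k).1.2.2.1
  let R : ℕ → ℕ := fun k => (st k).1.2.2.2.1
  let n : ℕ → ℕ := fun k => (st k).1.2.2.2.2.2
  have hn : ∀ k, n k + (k + 1) ^ 2 ≤ n (k + 1) := fun k => (hnext k (st k)).1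
  have hY : ∀ k, ∀ i < n (k + 1), Y (k + 1) i = Y k i := fun k => (hnext k (st k)).2.1
  have hpre : ∀ k, word (Y (k + 1)) 0 (n (k + 1)) ∈ 𝒢 (k + 1) := fun k => (hnext k (st k)).2.2.1
  have hchg : ∀ k m, ∑ i ∈ range m, ind (Y k i ≠ Y (k + 1) i) ≤ ε * (1 / 2) ^ (k + 1) * m :=
    fun k => (hnext k (st k)).2.2.2.1
  have h𝒢 : ∀ k, ∀ v ∈ 𝒢 (k + 1), v ∈ (𝒢 k)∗ ∧ n k + (k + 1) ^ 2 ≤ v.length ∧ v.length ≤ R (k + 1) ∧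
      word (Y k) 0 (n k + (k + 1) ^ 2) <:+: v := fun k => (hnext k (st k)).2.2.2.2.1
  have hfreq : ∀ k, ∀ u ∈ U k, ∃ c : ℝ, ∀ v ∈ 𝒢 (k + 1),
      |occ u v - c * v.length| ≤ 1 / (k + 1) * v.length := fun k => (hnext k (st k)).2.2.2.2.2
  have hnm : StrictMono n := strictMono_nat_of_lt_succ fun k => by
    have := hn k
    have : 0 < (k + 1) ^ 2 := by positivity
    omega
  have hnk : ∀ k, k ≤ n k := fun k => hnm.id_le k
  have hstab : ∀ k j, k ≤ j → ∀ i < n (k + 1), Y j i = Y k i := by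
    intro k j hkj
    induction j, hkj using Nat.le_induction with
    | base => exact fun _ _ => rfl
    | succ j hkj ih =>
      intro i hi
      rw [hY j i (hi.trans_le (hnm.monotone (Nat.succ_le_succ hkj))), ih i hi]
  let z : ℕ → A := fun i => Y i i
  have hzY : ∀ k i, i < n k ∨ i ≤ k → z i = Y k i := by
    intro k i hi
    rcases le_total i k with h | h
    · exact (hstab i k h i (by have := hnk (i + 1); omega)).symm
    · refine hstab k i h i ?_
      rcases hi with hi | hi
      · exact hi.trans (hnm (Nat.lt_succ_self k))
      · have := hnk (k + 1); omega
  have hstar : ∀ k j, k ≤ j → ∀ v ∈ 𝒢 j, v ∈ (𝒢 k)∗ := by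
    intro k j hkj
    induction j, hkj using Nat.le_induction with
    | base => exact fun v hv => mem_kstar_of_mem hv
    | succ j hkj ih => exact fun v hv => kstar_subset ih (h𝒢 j v hv).1
  -- Arbitrarily long initial words of `z` are blocks of later stages, hence products of words from
  -- `𝒢 k`. Every window of `z` is thus seen inside such a product.
  have hzpre : ∀ k m, ∃ N, m ≤ N ∧ word z 0 N ∈ (𝒢 k)∗ := by
    intro k m
    have h1 := hpre (k + m)
    refine ⟨n (k + m + 1), ?_, ?_⟩
    · have := hnk (k + m + 1); omega
    · have : word z 0 (n (k + m + 1)) = word (Y (k + m + 1)) 0 (n (k + m + 1)) :=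
        word_eq_word_iff.2 fun t ht => by rw [zero_add]; exact hzY (k + m + 1) t (Or.inl ht)
      rw [this]
      exact hstar k (k + m + 1) (by omega) _ h1
  refine ⟨z, fun u δ hδ => ?_, fun m => ?_, fun m => ?_⟩
  · obtain ⟨k, hk1, hk2⟩ := ((eventually_const_le hδ 3).and
      (eventually_ge_atTop u.length)).exists
    obtain ⟨c, hc⟩ := hfreq k u (by simpa [U] using hk2)
    have hk0 : (0 : ℝ) < k + 1 := by positivity
    have hu : ∀ v ∈ 𝒢 (k + 1), (u.length : ℝ) ≤ 1 / (k + 1) * v.length := by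
      intro v hv
      have h1 : ((k + 1) ^ 2 : ℝ) ≤ v.length := by
        have := (h𝒢 k v hv).2.1
        exact_mod_cast (by omega : (k + 1) ^ 2 ≤ v.length)
      have h2 : (u.length : ℝ) ≤ k := by exact_mod_cast hk2
      rw [one_div, inv_mul_eq_div, le_div_iff₀ hk0]
      nlinarith
    obtain ⟨l₀, hl₀⟩ := eventually_atTop.1 (eventually_const_le (ε := 1 / (k + 1)) (by positivity)
      (u.length + 2 * R (k + 1) + |c| * (2 * R (k + 1))))
    refine ⟨c, max l₀ (R (k + 1) + 1), fun l hl i => ?_⟩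
    obtain ⟨N, hN, hzN⟩ := hzpre (k + 1) (i + l)
    have h1 := abs_count_sub_le (fun v hv => (h𝒢 k v hv).2.2.1) hc hu (by positivity) hzN hN
      (by have := le_max_right l₀ (R (k + 1) + 1); omega)
    have h2 := hl₀ l ((le_max_left _ _).trans hl)
    have h3 : 3 * (1 / (k + 1) : ℝ) ≤ δ := by
      rw [mul_one_div, div_le_iff₀ hk0]
      nlinarith
    calc _ ≤ _ := h1
      _ ≤ (1 / (k + 1) + 1 / (k + 1)) * l + 1 / (k + 1) * l := by gcongr
      _ = 3 * (1 / (k + 1)) * l := by ring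
      _ ≤ δ * l := by gcongr
  -- A window of this length contains a complete block of stage `m + 1`, and every such block
  -- contains the first `m` letters of `z`.
  · refine ⟨2 * R (m + 1) + 1, fun i => ?_⟩
    obtain ⟨N, hN, hzN⟩ := hzpre (m + 1) (i + (2 * R (m + 1) + 1))
    obtain ⟨a, l', h1, h2, h3, h4, h5⟩ := exists_core (fun v hv => (h𝒢 m v hv).2.2.1) hzN hN
      (by omega)
    obtain ⟨Ls, hLs, hmem⟩ := Language.mem_kstar.1 h5
    have hne : Ls ≠ [] := by
      rintro rfl
      have := congrArg List.length hLs
      simp at this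
      omega
    obtain ⟨v, hv⟩ := List.exists_mem_of_ne_nil Ls hne
    have hinf : word z 0 m <:+: word z a l' := by
      rw [hLs]
      refine List.IsInfix.trans ?_ (List.infix_of_mem_flatten hv)
      refine List.IsInfix.trans ?_ (h𝒢 m v (hmem v hv)).2.2.2
      have e1 : word z 0 m = word (Y m) 0 m := word_eq_word_iff.2 fun t ht => by
        rw [zero_add]; exact hzY _ _ (Or.inr ht.le)
      have hmm : m ≤ (m + 1) ^ 2 := by nlinarith
      rw [e1, show n m + (m + 1) ^ 2 = m + (n m + (m + 1) ^ 2 - m) by omega, word_add]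
      exact (List.prefix_append _ _).isInfix
    obtain ⟨j, hj1, hj2⟩ := exists_of_infix_word hinf
    rw [length_word] at hj1 hj2
    refine ⟨a - i + j, by omega, ?_⟩
    rw [show i + (a - i + j) = a + j by omega]
    exact hj2
  · have hsum : ∀ K, ∑ i ∈ range m, ind (Y 0 i ≠ Y K i)
        ≤ (∑ k ∈ range K, ε * (1 / 2) ^ (k + 1)) * m := by
      intro K
      induction K with
      | zero => simp [ind]
      | succ K ih =>
        rw [Finset.sum_range_succ, add_mul]
        refine le_trans ?_ (add_le_add ih (hchg K m))
        rw [← Finset.sum_add_distrib]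
        refine Finset.sum_le_sum fun i _ => ?_
        by_cases h : Y 0 i = Y K i
        · rw [h]; linarith [ind_nonneg (Y K i ≠ Y K i)]
        · rw [ind_of (P := Y 0 i ≠ Y K i) h]
          linarith [ind_nonneg (Y K i ≠ Y (K + 1) i), ind_le_one (Y 0 i ≠ Y (K + 1) i)]
    have hgeom : ∑ k ∈ range m, ε * (1 / 2) ^ (k + 1) ≤ ε := by
      calc _ = ε * (1 / 2) * ∑ k ∈ range m, (1 / 2 : ℝ) ^ k := by
            rw [Finset.mul_sum]
            exact Finset.sum_congr rfl fun k _ => by ring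
        _ ≤ ε * (1 / 2) * 2 := by gcongr; exact sum_geometric_two_le _
        _ = ε := by ring
    calc _ = ∑ i ∈ range m, ind (Y 0 i ≠ Y m i) := by
          refine Finset.sum_congr rfl fun i hi => ?_
          rw [hzY m i (Or.inr (Finset.mem_range.1 hi).le)]
          rfl
      _ ≤ _ := hsum m
      _ ≤ ε * m := by gcongr

end Uniform

/-! ### Invariant measures and unique ergodicity -/

section Krylov

variable {X : Type*} [TopologicalSpace X] [T2Space X] [CompactSpace X] [HasOuterApproxClosed X]
  [MeasurableSpace X] [BorelSpace X] {T : X → X}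

/-- Along every ultrafilter, the ergodic averages at a point converge to the integrals with respect
to an invariant measure. -/
lemma exists_invariant_of_ultrafilter (hT : Continuous T) (a : X) (𝒰 : Ultrafilter ℕ)
    (h𝒰 : (𝒰 : Filter ℕ) ≤ atTop) : ∃ μ : Measure X, IsProbabilityMeasure μ ∧
      MeasurePreserving T μ μ ∧ ∀ f : X → ℝ, Continuous f →
        Tendsto (fun n : ℕ => (1 / (n : ℝ)) * ∑ i ∈ range n, f (T^[i + 1] a)) 𝒰
          (𝓝 (∫ x, f x ∂μ)) := by
  classical
  let emp : ℕ → Measure X := fun n =>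
    if n = 0 then Measure.dirac a
    else (n : ENNReal)⁻¹ • ∑ i ∈ range n, Measure.dirac (T^[i + 1] a)
  have hemp : ∀ n, IsProbabilityMeasure (emp n) := by
    intro n
    by_cases hn : n = 0
    · simp only [emp, hn, if_true]; infer_instance
    · constructor
      simp only [emp, hn, if_false, Measure.smul_apply, Measure.finsetSum_apply, measure_univ,
        Finset.sum_const, Finset.card_range, nsmul_eq_mul, mul_one, smul_eq_mul]
      exact ENNReal.inv_mul_cancel (by exact_mod_cast hn) (ENNReal.natCast_ne_top n)
  let P : ℕ → ProbabilityMeasure X := fun n => ⟨emp n, hemp n⟩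
  obtain ⟨μ, -, hμ⟩ := (isCompact_univ (X := ProbabilityMeasure X)).ultrafilter_le_nhds
    (𝒰.map P) (by simp)
  have hμ' : Tendsto P 𝒰 (𝓝 μ) := hμ
  rw [ProbabilityMeasure.tendsto_iff_forall_integral_tendsto] at hμ'
  have hne : ∀ᶠ n in (𝒰 : Filter ℕ), 1 ≤ n := h𝒰 (eventually_ge_atTop 1)
  have key : ∀ f : X → ℝ, Continuous f →
      Tendsto (fun n : ℕ => (1 / (n : ℝ)) * ∑ i ∈ range n, f (T^[i + 1] a)) 𝒰
          (𝓝 (∫ x, f x ∂(μ : Measure X))) := by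
    intro f hf
    refine (hμ' (BoundedContinuousFunction.mkOfCompact ⟨f, hf⟩)).congr' ?_
    filter_upwards [hne] with n hn
    have hn0 : n ≠ 0 := by omega
    simp only [P, emp, ProbabilityMeasure.coe_mk, hn0, if_false,
      BoundedContinuousFunction.mkOfCompact_apply, ContinuousMap.coe_mk]
    rw [integral_smul_measure, integral_finsetSum_measure]
    · simp
    · intro i _
      exact integrable_dirac (by simp)
  refine ⟨μ, inferInstance, ⟨hT.measurable, ?_⟩, key⟩
  have : IsProbabilityMeasure (Measure.map T (μ : Measure X)) :=
    Measure.isProbabilityMeasure_map hT.measurable.aemeasurable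
  refine ext_of_forall_integral_eq_of_IsFiniteMeasure fun f => ?_
  rw [integral_map hT.measurable.aemeasurable f.continuous.aestronglyMeasurable]
  refine tendsto_nhds_unique (key _ (f.continuous.comp hT)) ?_
  have h1 := key f f.continuous
  -- The averages of `f ∘ T` and `f` differ by this telescoped boundary term, so the limit measure
  -- is invariant.
  have h2 : Tendsto (fun n : ℕ => (1 / (n : ℝ)) * (f (T^[n + 1] a) - f (T^[1] a))) 𝒰 (𝓝 0) := by
    refine Tendsto.mono_left ?_ h𝒰
    obtain ⟨M, hM⟩ : ∃ M, ∀ x, |f x| ≤ M := ⟨‖f‖, fun x => f.norm_coe_le_norm x⟩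
    refine bdd_le_mul_tendsto_zero' (2 * M) (Eventually.of_forall fun n => ?_)
      tendsto_one_div_atTop_nhds_zero_nat |>.congr fun n => mul_comm _ _
    refine (abs_sub _ _).trans ?_
    linarith [hM (T^[n + 1] a), hM (T^[1] a)]
  have h3 := h1.add h2
  rw [add_zero] at h3
  refine h3.congr fun n => ?_
  rw [← mul_add]
  congr 1
  have e := Finset.sum_range_succ (fun i => f (T^[i + 1] a)) n
  have e' := Finset.sum_range_succ' (fun i => f (T^[i + 1] a)) n
  simp only [← Function.iterate_succ_apply' T] at e' ⊢
  simp only [zero_add] at e'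
  linarith

lemma exists_invariant [Nonempty X] (hT : Continuous T) :
    ∃ μ : Measure X, IsProbabilityMeasure μ ∧ MeasurePreserving T μ μ := by
  obtain ⟨μ, h1, h2, -⟩ := exists_invariant_of_ultrafilter hT (Classical.arbitrary X)
    (hyperfilter ℕ) (by rw [← Nat.cofinite_eq_atTop]; exact hyperfilter_le_cofinite)
  exact ⟨μ, h1, h2⟩

/-- In a uniquely ergodic system all points are generic. -/
lemma IsUniquelyErgodic.isGeneric (hT : Continuous T) {μ : Measure X}
    [IsProbabilityMeasure μ] (hμ : ∀ ν : Measure X, IsProbabilityMeasure ν →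
      MeasurePreserving T ν ν → ν = μ) (a : X) : IsGeneric T μ a := by
  have real : ∀ f : X → ℝ, Continuous f →
      Tendsto (fun n : ℕ => (1 / (n : ℝ)) * ∑ i ∈ range n, f (T^[i + 1] a)) atTop
          (𝓝 (∫ x, f x ∂μ)) := by
    intro f hf
    -- Along every ultrafilter the averages converge to the integral of some invariant measure, and
    -- there is only one.
    rw [tendsto_iff_ultrafilter]
    intro 𝒰 h𝒰
    obtain ⟨ν, h1, h2, h3⟩ := exists_invariant_of_ultrafilter hT a 𝒰 h𝒰
    rw [← hμ ν h1 h2]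
    exact h3 f hf
  intro f hf
  have hint : Integrable f μ := hf.integrable_of_hasCompactSupport (HasCompactSupport.of_compactSpace f)
  have h1 := (Complex.continuous_ofReal.tendsto _).comp (real _ (Complex.continuous_re.comp hf))
  have h2 := (Complex.continuous_ofReal.tendsto _).comp (real _ (Complex.continuous_im.comp hf))
  have h3 := h1.add (h2.mul_const Complex.I)
  have e : (∫ x, f x ∂μ) = ((∫ x, (f x).re ∂μ : ℝ) : ℂ) + ((∫ x, (f x).im ∂μ : ℝ) : ℂ) * Complex.I :=
    (integral_re_add_im hint).symm
  rw [e]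
  refine h3.congr fun n => ?_
  simp only [Function.comp_apply]
  push_cast
  rw [mul_assoc, ← mul_add, Finset.sum_mul, ← Finset.sum_add_distrib]
  simp only [Complex.re_add_im]

end Krylov

/-- The invariant measure of a uniquely ergodic system is ergodic. -/
lemma ergodic_of_unique {X : Type*} [MeasurableSpace X] {T : X → X} {μ : Measure X}
    [IsProbabilityMeasure μ] (hμT : MeasurePreserving T μ μ)
    (hμ : ∀ ν : Measure X, IsProbabilityMeasure ν → MeasurePreserving T ν ν → ν = μ) :
    Ergodic T μ := by
  refine ⟨hμT, ⟨fun s hs hTs => ?_⟩⟩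
  rw [Filter.eventuallyConst_set']
  by_cases h0 : μ s = 0
  · left; exact ae_eq_empty.2 h0
  right
  -- Conditioning on an invariant set of positive measure gives another invariant measure. By
  -- uniqueness it is `μ`, so the complement is null.
  have hprob : IsProbabilityMeasure (ProbabilityTheory.cond μ s) :=
    ProbabilityTheory.cond_isProbabilityMeasure h0
  have hpres : MeasurePreserving T (ProbabilityTheory.cond μ s) (ProbabilityTheory.cond μ s) := by
    have h1 := hμT.restrict_preimage hs
    rw [hTs] at h1
    exact h1.smul_measure _
  have h2 := hμ _ hprob hpres
  rw [ae_eq_univ, ← h2, ProbabilityTheory.cond_apply hs]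
  simp

/-! ### Strict ergodicity of the orbit closure -/

section OrbitClosure

variable {A : Type*}

/-- The sequences all of whose initial words occur in `z`. -/
def orbitClosure (z : ℕ → A) : Set (ℕ → A) := {ξ | ∀ m, ∃ p, word ξ 0 m = word z p m}

lemma self_mem_orbitClosure (z : ℕ → A) : z ∈ orbitClosure z := fun _ => ⟨0, rfl⟩

lemma word_shift (ξ : ℕ → A) (p m : ℕ) : word (shift ξ) p m = word ξ (p + 1) m :=
  word_eq_word_iff.2 fun t _ => by
    simp only [shift]; congr 1; ring

lemma shift_mem_orbitClosure {z ξ : ℕ → A} (h : ξ ∈ orbitClosure z) :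
    shift ξ ∈ orbitClosure z := by
  intro m
  obtain ⟨p, hp⟩ := h (1 + m)
  refine ⟨p + 1, ?_⟩
  rw [word_add, word_add] at hp
  have := (List.append_inj hp (by simp)).2
  rw [word_shift]
  exact this

/-- The shift on the orbit closure of `z`. -/
def orbitShift (z : ℕ → A) (ξ : orbitClosure z) : orbitClosure z :=
  ⟨shift ξ.1, shift_mem_orbitClosure ξ.2⟩

lemma orbitShift_iterate (z : ℕ → A) (ξ : orbitClosure z) (i n : ℕ) :
    ((orbitShift z)^[i] ξ).1 n = ξ.1 (n + i) := by
  induction i generalizing n with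
  | zero => rfl
  | succ i ih =>
    rw [Function.iterate_succ_apply']
    change ((orbitShift z)^[i] ξ).1 (n + 1) = _
    rw [ih, add_assoc, add_comm 1]

lemma continuous_shift [TopologicalSpace A] : Continuous (shift : (ℕ → A) → (ℕ → A)) :=
  continuous_pi fun n => continuous_apply (n + 1)

lemma continuous_orbitShift [TopologicalSpace A] (z : ℕ → A) :
    Continuous (orbitShift z) :=
  (continuous_shift.comp continuous_subtype_val).subtype_mk _

variable [TopologicalSpace A] [DiscreteTopology A]

lemma isClopen_word (m : ℕ) (W : Set (List A)) : IsClopen {ξ : ℕ → A | word ξ 0 m ∈ W} := by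
  have hc : Continuous fun (ξ : ℕ → A) (t : Fin m) => ξ t :=
    continuous_pi fun t => continuous_apply (t : ℕ)
  have : {ξ : ℕ → A | word ξ 0 m ∈ W} =
      (fun (ξ : ℕ → A) (t : Fin m) => ξ t) ⁻¹' {η | List.ofFn η ∈ W} := by
    ext ξ
    have : word ξ 0 m = List.ofFn fun t : Fin m => ξ t :=
      List.ext_getElem (by simp) fun t _ _ => by simp [word]
    simp only [Set.mem_ofPred_eq, Set.mem_preimage, this]
  rw [this]
  exact (isClopen_discrete _).preimage hc

lemma isClosed_orbitClosure (z : ℕ → A) : IsClosed (orbitClosure z) := by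
  have : orbitClosure z = ⋂ m, {ξ | word ξ 0 m ∈ Set.range fun p => word z p m} := by
    ext ξ
    simp only [orbitClosure, Set.mem_ofPred_eq, Set.mem_iInter, Set.mem_range, eq_comm]
  rw [this]
  exact isClosed_iInter fun m => (isClopen_word m _).isClosed

lemma exists_word_subset_of_mem_nhds {ξ : ℕ → A} {V : Set (ℕ → A)} (hV : V ∈ 𝓝 ξ) :
    ∃ m, {η | word η 0 m = word ξ 0 m} ⊆ V := by
  obtain ⟨O, hOV, hO, hξ⟩ := mem_nhds_iff.1 hV
  obtain ⟨_, ⟨x, m, rfl⟩, hx, hs⟩ :=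
    (PiNat.isTopologicalBasis_cylinders fun _ : ℕ => A).exists_subset_of_mem_open hξ hO
  refine ⟨m, fun η hη => hOV (hs fun i hi => ?_)⟩
  have := word_eq_word_iff.1 hη i hi
  rw [zero_add] at this
  rw [this, hx i hi]

/-- A word of `ζ` occurs in some initial word of `z`, which recurs in `z` with bounded gaps. Every
long word of `ξ` occurs in `z` and so contains it. -/
lemma UniformRec.isMinimal {z : ℕ → A} (hz : UniformRec z) : IsMinimal (orbitShift z) := by
  intro ξ
  rw [dense_iff_closure_eq, Set.eq_univ_iff_forall]
  intro ζ
  rw [mem_closure_iff_nhds]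
  intro V hV
  obtain ⟨V', hV', hsub⟩ := mem_nhds_subtype _ _ _ |>.1 hV
  obtain ⟨m, hm⟩ := exists_word_subset_of_mem_nhds hV'
  obtain ⟨p, hp⟩ := ζ.2 m
  obtain ⟨R, hR⟩ := hz (p + m)
  obtain ⟨q, hq⟩ := ξ.2 (R + (p + m))
  obtain ⟨j, hj, hw⟩ := hR q
  refine ⟨(orbitShift z)^[j + p] ξ, hsub (hm ?_), ⟨j + p, rfl⟩⟩
  refine word_eq_word_iff.2 fun t ht => ?_
  rw [orbitShift_iterate]
  have h1 := word_eq_word_iff.1 hp t ht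
  have h2 := word_eq_word_iff.1 hq (j + p + t) (by omega)
  have h3 := word_eq_word_iff.1 hw (p + t) (by omega)
  rw [h1, show 0 + t + (j + p) = 0 + (j + p + t) by ring, h2,
    show q + (j + p + t) = q + j + (p + t) by ring, h3, zero_add]

section Measure

variable {z : ℕ → A} [MeasurableSpace (orbitClosure z)] [BorelSpace (orbitClosure z)]

lemma measurableSet_orbit_word (u : List A) :
    MeasurableSet {ξ : orbitClosure z | word ξ.1 0 u.length = u} :=
  ((isClopen_word u.length {u}).preimage continuous_subtype_val).isOpen.measurableSet

/-- By invariance the measure of the cylinder is the integral of its visit frequency over `l` steps.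
This frequency is within `δ` of `c` at every point, since all words of the point occur in `z`. -/
lemma UniformFreq.abs_measure_sub_le {u : List A} {δ c : ℝ} {l : ℕ} (hl : 1 ≤ l)
    (h : ∀ i, |∑ j ∈ range l, ind (word z (i + j) u.length = u) - c * l| ≤ δ * l)
    {μ : Measure (orbitClosure z)} [IsProbabilityMeasure μ]
    (hμ : MeasurePreserving (orbitShift z) μ μ) :
    |μ.real {ξ : orbitClosure z | word ξ.1 0 u.length = u} - c| ≤ δ := by
  have hl0 : (0 : ℝ) < l := by exact_mod_cast hl
  set S := {ξ : orbitClosure z | word ξ.1 0 u.length = u} with hS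
  have hSm : MeasurableSet S := measurableSet_orbit_word u
  have hSj : ∀ j, MeasurableSet ((orbitShift z)^[j] ⁻¹' S) := fun j =>
    (hμ.iterate j).measurable hSm
  have hind : ∀ j (ξ : orbitClosure z), ((orbitShift z)^[j] ⁻¹' S).indicator (fun _ => (1 : ℝ)) ξ
      = ind (word ξ.1 j u.length = u) := by
    intro j ξ
    have : ξ ∈ (orbitShift z)^[j] ⁻¹' S ↔ word ξ.1 j u.length = u := by
      simp only [Set.mem_preimage, hS, Set.mem_ofPred_eq]
      have e : word ((orbitShift z)^[j] ξ).1 0 u.length = word ξ.1 j u.length :=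
        word_eq_word_iff.2 fun t _ => by
          rw [orbitShift_iterate, zero_add, add_comm]
      rw [e]
    by_cases hξ : ξ ∈ (orbitShift z)^[j] ⁻¹' S
    · rw [Set.indicator_of_mem hξ, ind_of (this.1 hξ)]
    · rw [Set.indicator_of_notMem hξ, ind_of_not fun h => hξ (this.2 h)]
  have hint : ∀ j, Integrable (((orbitShift z)^[j] ⁻¹' S).indicator (fun _ => (1 : ℝ))) μ :=
    fun j => (integrable_const _).indicator (hSj j)
  have h1 : ∫ ξ, (∑ j ∈ range l, ((orbitShift z)^[j] ⁻¹' S).indicator (fun _ => (1 : ℝ)) ξ) ∂μ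
      = l * μ.real S := by
    rw [integral_finsetSum _ fun j _ => hint j]
    have : ∀ j, ∫ ξ, ((orbitShift z)^[j] ⁻¹' S).indicator (fun _ => (1 : ℝ)) ξ ∂μ = μ.real S := by
      intro j
      rw [integral_indicator_const _ (hSj j), smul_eq_mul, mul_one, measureReal_def,
        (hμ.iterate j).measure_preimage hSm.nullMeasurableSet, measureReal_def]
    simp [this]
  have h2 : ∀ ξ : orbitClosure z,
      |∑ j ∈ range l, ((orbitShift z)^[j] ⁻¹' S).indicator (fun _ => (1 : ℝ)) ξ - c * l| ≤ δ * l := by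
    intro ξ
    simp only [hind]
    obtain ⟨p, hp⟩ := ξ.2 (l + u.length)
    refine le_trans (le_of_eq ?_) (h p)
    congr 2
    refine Finset.sum_congr rfl fun j hj => ?_
    have hj := Finset.mem_range.1 hj
    have : word ξ.1 j u.length = word z (p + j) u.length := word_eq_word_iff.2 fun t ht => by
      have := word_eq_word_iff.1 hp (j + t) (by omega)
      rwa [zero_add, ← add_assoc] at this
    rw [this]
  have h3 : |∫ ξ, (∑ j ∈ range l, ((orbitShift z)^[j] ⁻¹' S).indicator (fun _ => (1 : ℝ)) ξ
      - c * l) ∂μ| ≤ δ * l := by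
    have := norm_integral_le_of_norm_le_const (μ := μ) (C := δ * l) (f := fun ξ => ∑ j ∈ range l,
      ((orbitShift z)^[j] ⁻¹' S).indicator (fun _ => (1 : ℝ)) ξ - c * l) (Eventually.of_forall h2)
    simpa using this
  rw [integral_sub (integrable_finsetSum _ fun j _ => hint j) (integrable_const _), h1] at h3
  simp only [integral_const, probReal_univ, smul_eq_mul, one_mul] at h3
  have e : (l : ℝ) * μ.real S - c * l = l * (μ.real S - c) := by ring
  rw [e, abs_mul, Nat.abs_cast, mul_comm] at h3
  exact le_of_mul_le_mul_right h3 hl0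

/-- Both measures give a cylinder nearly the same value `c`, for every tolerance, and the cylinders
generate the Borel sets and are closed under nonempty intersections. -/
lemma UniformFreq.eq_of_invariant [Finite A] (hz : UniformFreq z) {μ ν : Measure (orbitClosure z)}
    [IsProbabilityMeasure μ] [IsProbabilityMeasure ν] (hμ : MeasurePreserving (orbitShift z) μ μ)
    (hν : MeasurePreserving (orbitShift z) ν ν) : μ = ν := by
  let 𝒞 : Set (Set (orbitClosure z)) :=
    {S | ∃ u : List A, S = {ξ : orbitClosure z | word ξ.1 0 u.length = u}}
  have hbasis : TopologicalSpace.IsTopologicalBasis 𝒞 := by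
    refine TopologicalSpace.isTopologicalBasis_of_isOpen_of_nhds ?_ fun ξ V hξ hV => ?_
    · rintro _ ⟨u, rfl⟩
      exact ((isClopen_word u.length {u}).preimage continuous_subtype_val).isOpen
    · obtain ⟨V', hV', hsub⟩ := mem_nhds_subtype _ _ _ |>.1 (hV.mem_nhds hξ)
      obtain ⟨m, hm⟩ := exists_word_subset_of_mem_nhds hV'
      refine ⟨_, ⟨word ξ.1 0 m, rfl⟩, ?_, fun η hη => hsub (hm ?_)⟩
      · simp
      · simpa using hη
  refine ext_of_generate_finite 𝒞 ?_ ?_ ?_ (by simp)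
  · rw [BorelSpace.measurable_eq (α := orbitClosure z)]
    exact hbasis.borel_eq_generateFrom
  · have key : ∀ u v : List A, u.length ≤ v.length →
        ({ξ : orbitClosure z | word ξ.1 0 u.length = u} ∩
          {ξ : orbitClosure z | word ξ.1 0 v.length = v}).Nonempty →
        {ξ : orbitClosure z | word ξ.1 0 u.length = u} ∩
          {ξ : orbitClosure z | word ξ.1 0 v.length = v}
          = {ξ : orbitClosure z | word ξ.1 0 v.length = v} := by
      rintro u v huv ⟨η, hη1, hη2⟩
      refine Set.inter_eq_right.2 fun ξ hξ => ?_
      refine (word_eq_word_iff.2 fun t ht => ?_ :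
        word ξ.1 0 u.length = word η.1 0 u.length).trans hη1
      exact word_eq_word_iff.1 (hξ.trans hη2.symm) t (by omega)
    rintro _ ⟨u, rfl⟩ _ ⟨v, rfl⟩ hne
    rcases le_total u.length v.length with h | h
    · exact ⟨v, key u v h hne⟩
    · rw [Set.inter_comm] at hne ⊢
      exact ⟨u, key v u h hne⟩
  · rintro _ ⟨u, rfl⟩
    rw [← measureReal_eq_measureReal_iff]
    refine eq_of_forall_dist_le fun ε hε => ?_
    obtain ⟨c, l₀, hl₀⟩ := hz u (ε / 2) (by positivity)
    have h := hl₀ (l₀ + 1) (by omega)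
    have h1 := UniformFreq.abs_measure_sub_le (by omega) h hμ
    have h2 := UniformFreq.abs_measure_sub_le (by omega) h hν
    rw [Real.dist_eq]
    rw [abs_le] at *
    constructor <;> linarith

end Measure

end OrbitClosure

/-- Sequences with uniform frequencies and uniform recurrence are strictly ergodic. -/
theorem isStrictlyErgodicSeq_of_uniform {A : Type} [Finite A] {z : ℕ → A} (hf : UniformFreq z)
    (hr : UniformRec z) (g : A → ℂ) : IsStrictlyErgodicSeq (fun n => g (z n)) := by
  let : TopologicalSpace A := ⊥
  have : DiscreteTopology A := ⟨rfl⟩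
  let : MetricSpace (orbitClosure z) := TopologicalSpace.metrizableSpaceMetric _
  have : CompactSpace (orbitClosure z) :=
    isCompact_iff_compactSpace.1 (isClosed_orbitClosure z).isCompact
  let : MeasurableSpace (orbitClosure z) := borel _
  have : BorelSpace (orbitClosure z) := ⟨rfl⟩
  have : Nonempty (orbitClosure z) := ⟨⟨z, self_mem_orbitClosure z⟩⟩
  have hT := continuous_orbitShift z
  have hmin := hr.isMinimal
  -- A strictly ergodic sequence is read off from `T a` onwards, so `z` needs a preimage `a`. The
  -- range is closed and contains a dense forward orbit.
  have hsurj : Function.Surjective (orbitShift z) := by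
    have hcl : IsClosed (Set.range (orbitShift z)) := (isCompact_range hT).isClosed
    have hd := hmin (orbitShift z (Classical.arbitrary _))
    rw [← Set.range_eq_univ, ← hcl.closure_eq]
    refine Set.eq_univ_of_univ_subset ?_
    rw [← hd.closure_eq]
    refine closure_mono ?_
    rintro _ ⟨n, rfl⟩
    exact ⟨(orbitShift z)^[n] (Classical.arbitrary _), by
      simp only [← Function.iterate_succ_apply, ← Function.iterate_succ_apply' (orbitShift z)]⟩
  obtain ⟨a, ha⟩ := hsurj ⟨z, self_mem_orbitClosure z⟩
  obtain ⟨μ, hμ1, hμ2⟩ := exists_invariant hT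
  refine ⟨orbitClosure z, inferInstance, inferInstance, inferInstance, inferInstance, orbitShift z,
    fun ξ => g (ξ.1 0), a, hT, ⟨hmin, μ, ⟨hμ1, hμ2⟩, ?_⟩, ?_, fun n => ?_⟩
  · rintro ν ⟨hν1, hν2⟩
    exact hf.eq_of_invariant hν2 hμ2
  · exact continuous_of_discreteTopology.comp ((continuous_apply 0).comp continuous_subtype_val)
  · simp only [Function.iterate_succ_apply, ha, orbitShift_iterate, zero_add]

/-! ### Generic points of ergodic measures -/

/-- The mean ergodic theorem for bounded functions and ergodic measures. -/
lemma tendsto_integral_abs_average_sub {X : Type*} [MeasurableSpace X] {T : X → X}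
    {μ : Measure X} [IsProbabilityMeasure μ] (hT : Ergodic T μ) {f : X → ℝ} (hf : Measurable f)
    {M : ℝ} (hM : ∀ x, |f x| ≤ M) : ∃ c : ℝ, Tendsto (fun N : ℕ =>
      ∫ x, |(∑ j ∈ range N, f (T^[j] x)) / N - c| ∂μ) atTop (𝓝 0) := by
  have hTp := hT.toMeasurePreserving
  have hfj : ∀ j, MemLp (fun x => f (T^[j] x)) 2 μ := fun j =>
    MemLp.of_bound (hf.comp (hTp.iterate j).measurable).aestronglyMeasurable M
      (Eventually.of_forall fun x => hM _)
  have hf0 : MemLp f 2 μ := hfj 0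
  let V := (Lp.compMeasurePreservingₗᵢ (E := ℝ) (p := 2) ℝ T hTp).toContinuousLinearMap
  have hV : ‖V‖ ≤ 1 := LinearIsometry.norm_toContinuousLinearMap_le _
  let F : Lp ℝ 2 μ := hf0.toLp f
  -- Von Neumann's theorem for the Koopman operator: the averages converge in `L²` to an invariant
  -- function, constant by ergodicity. Convergence in `L¹` follows.
  have hlim := V.tendsto_birkhoffAverage_orthogonalProjection hV F
  set G := ((V.eqLocus (1 : Lp ℝ 2 μ →L[ℝ] Lp ℝ 2 μ)).orthogonalProjectionOnto F : Lp ℝ 2 μ)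
    with hG
  have hGfix : V G = G :=
    ((V.eqLocus (1 : Lp ℝ 2 μ →L[ℝ] Lp ℝ 2 μ)).orthogonalProjectionOnto F).2
  obtain ⟨c, hc⟩ : ∃ c : ℝ, (G : X → ℝ) =ᵐ[μ] fun _ => c := by
    refine hT.ae_eq_const_of_ae_eq_comp_ae (Lp.aestronglyMeasurable G) ?_
    have := Lp.coeFn_compMeasurePreserving G hTp
    have e : Lp.compMeasurePreserving T hTp G = G := hGfix
    rw [e] at this
    exact this.symm
  refine ⟨c, ?_⟩
  have havg : ∀ N : ℕ, ((birkhoffAverage ℝ V _root_.id N F : Lp ℝ 2 μ) : X → ℝ)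
      =ᵐ[μ] fun x => (∑ j ∈ range N, f (T^[j] x)) / N := by
    intro N
    have hit : ∀ j, V^[j] F = (hfj j).toLp _ := by
      intro j
      have : (V : Lp ℝ 2 μ → Lp ℝ 2 μ) = Lp.compMeasurePreserving T hTp := rfl
      rw [this, Lp.compMeasurePreserving_iterate]
      rfl
    have hsum : ((∑ j ∈ range N, V^[j] F : Lp ℝ 2 μ) : X → ℝ)
        =ᵐ[μ] fun x => ∑ j ∈ range N, f (T^[j] x) := by
      have h1 := Lp.coeFn_finsetSum (range N) (fun j => V^[j] F)
      have h2 : ∀ᵐ x ∂μ, ∀ j ∈ range N, (V^[j] F : Lp ℝ 2 μ) x = f (T^[j] x) := by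
        rw [Filter.eventually_all_finset]
        intro j _
        rw [hit j]
        exact (hfj j).coeFn_toLp
      filter_upwards [h1, h2] with x hx1 hx2
      rw [hx1, Finset.sum_apply]
      exact Finset.sum_congr rfl fun j hj => hx2 j hj
    have h3 := Lp.coeFn_smul ((N : ℝ)⁻¹) (∑ j ∈ range N, V^[j] F : Lp ℝ 2 μ)
    filter_upwards [h3, hsum] with x hx1 hx2
    simp only [birkhoffAverage, birkhoffSum, id]
    rw [hx1, Pi.smul_apply, hx2, smul_eq_mul, inv_mul_eq_div]
  have hnorm : Tendsto (fun N : ℕ => ‖birkhoffAverage ℝ V _root_.id N F - G‖) atTop (𝓝 0) :=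
    tendsto_iff_norm_sub_tendsto_zero.1 hlim
  refine squeeze_zero (fun N => integral_nonneg fun x => abs_nonneg _) (fun N => ?_) hnorm
  set H := birkhoffAverage ℝ V _root_.id N F - G with hH
  have hHe : (H : X → ℝ) =ᵐ[μ] fun x => (∑ j ∈ range N, f (T^[j] x)) / N - c := by
    filter_upwards [Lp.coeFn_sub (birkhoffAverage ℝ V _root_.id N F) G, havg N, hc]
      with x h1 h2 h3
    rw [h1, Pi.sub_apply, h2, h3]
  have e1 : ∫ x, |(∑ j ∈ range N, f (T^[j] x)) / N - c| ∂μ = ∫ x, ‖H x‖ ∂μ :=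
    integral_congr_ae (hHe.mono fun x hx => by simp only [hx, Real.norm_eq_abs])
  rw [e1, integral_norm_eq_lintegral_enorm (Lp.aestronglyMeasurable H), Lp.norm_def,
    ← eLpNorm_one_eq_lintegral_enorm]
  refine ENNReal.toReal_mono (Lp.eLpNorm_ne_top H) ?_
  exact eLpNorm_le_eLpNorm_of_exponent_le (by norm_num) (Lp.aestronglyMeasurable H)

lemma shift_iterate {A : Type*} (y : ℕ → A) (i n : ℕ) : (shift^[i] y) n = y (n + i) := by
  induction i generalizing n with
  | zero => rfl
  | succ i ih =>
    rw [Function.iterate_succ_apply']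
    change (shift^[i] y) (n + 1) = _
    rw [ih, add_assoc, add_comm 1]

/-- A point which is generic for an ergodic measure has the ergodic property. -/
theorem IsGeneric.ergSeq {A : Type*} [TopologicalSpace A] [DiscreteTopology A] [Finite A]
    [MeasurableSpace A] [BorelSpace A] {y : ℕ → A} {ν : Measure (ℕ → A)}
    [IsProbabilityMeasure ν] (hν : Ergodic shift ν) (hy : IsGeneric shift ν y) : ErgSeq y := by
  intro v hv
  obtain ⟨D, hD⟩ := hv
  let W : Set (List A) := {u | ∃ i, D ≤ i ∧ word y (i - D) (2 * D + 1) = u ∧ v i}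
  let f : (ℕ → A) → ℝ := fun ξ => ind (word ξ 0 (2 * D + 1) ∈ W)
  -- The offset has `D` places for the left half of the window and one because the averages in
  -- `IsGeneric` start at the first iterate.
  have hfv : ∀ i, ind (v (i + (D + 1))) = f (shift^[i + 1] y) := by
    intro i
    simp only [f]
    congr 1
    have hw : word (shift^[i + 1] y) 0 (2 * D + 1) = word y (i + (D + 1) - D) (2 * D + 1) :=
      word_eq_word_iff.2 fun t _ => by
        rw [shift_iterate]; congr 1; omega
    rw [hw, eq_iff_iff]
    constructor
    · intro h
      exact ⟨i + (D + 1), by omega, rfl, h⟩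
    · rintro ⟨j, hj, hjw, hvj⟩
      rw [hD (i + (D + 1)) j (by omega) hj fun t ht => ?_]
      · exact hvj
      · exact (word_eq_word_iff.1 hjw t (by omega)).symm
  have hcont : Continuous f := by
    have h1 := isClopen_word (A := A) (2 * D + 1) W
    have : f = {ξ : ℕ → A | word ξ 0 (2 * D + 1) ∈ W}.indicator fun _ => 1 := by
      funext ξ
      by_cases h : word ξ 0 (2 * D + 1) ∈ W
      · rw [Set.indicator_of_mem (by exact h)]; exact ind_of h
      · rw [Set.indicator_of_notMem (by exact h)]; exact ind_of_not h
    rw [this]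
    exact (continuous_const).indicator fun a ha => by simp [h1.frontier_eq] at ha
  obtain ⟨c, hc⟩ := tendsto_integral_abs_average_sub hν hcont.measurable
    (M := 1) fun ξ => by
      rw [abs_of_nonneg (ind_nonneg _)]; exact ind_le_one _
  refine ErgMean.of_shift (D + 1) fun ε hε => ⟨c, ?_⟩
  filter_upwards [hc.eventually (gt_mem_nhds (half_pos hε))] with N hN
  -- For fixed `N` the deviation is a continuous function with integral less than `ε`, so genericity
  -- carries the bound over to the orbit of `y`.
  let g : (ℕ → A) → ℝ := fun ξ => |(∑ j ∈ range N, f (shift^[j] ξ)) / N - c|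
  have hg : Continuous g := by
    refine Continuous.abs (Continuous.sub (Continuous.div_const (continuous_finsetSum _
      fun j _ => hcont.comp (continuous_shift.iterate j)) _) continuous_const)
  have hgen := hy (fun ξ => (g ξ : ℂ)) (Complex.continuous_ofReal.comp hg)
  rw [integral_complex_ofReal] at hgen
  have hre := (Complex.continuous_re.tendsto _).comp hgen
  rw [Complex.ofReal_re] at hre
  filter_upwards [hre.eventually (gt_mem_nhds (show ∫ ξ, g ξ ∂ν < ε by
    simp only [g]; linarith)), eventually_ge_atTop 1] with n hn hn1
  have hn0 : (0 : ℝ) < n := by exact_mod_cast hn1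
  have e : ((1 / (n : ℂ)) * ∑ i ∈ range n, ((g (shift^[i + 1] y) : ℝ) : ℂ)).re
      = (1 / (n : ℝ)) * ∑ i ∈ range n, g (shift^[i + 1] y) := by
    rw [← Complex.ofReal_re ((1 / (n : ℝ)) * ∑ i ∈ range n, g (shift^[i + 1] y))]
    push_cast
    rfl
  simp only [Function.comp_apply] at hn
  rw [e, one_div, inv_mul_lt_iff₀ hn0] at hn
  rw [mul_comm]
  refine le_trans (le_of_eq (Finset.sum_congr rfl fun i _ => ?_)) hn.le
  simp only [g, mavg]
  congr 3
  refine Finset.sum_congr rfl fun j _ => ?_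
  rw [hfv, ← Function.iterate_add_apply]
  congr 2
  ring

/-- A strictly ergodic point is generic for an ergodic measure. -/
theorem IsStrictlyErgodicSeq.isGenericForErgodic {K : Finset ℂ} {y : ℕ → K}
    (hy : IsStrictlyErgodicSeq fun n => (y n : ℂ)) : IsGenericForErgodic y := by
  obtain ⟨X, _, _, _, _, T, f, a, hT, ⟨hmin, μ, ⟨hμ, hμT⟩, huniq⟩, hf, hfy⟩ := hy
  replace hfy : ∀ n, (y n : ℂ) = f (T^[n + 1] a) := hfy
  have huniq' : ∀ ν, IsProbabilityMeasure ν → MeasurePreserving T ν ν → ν = μ :=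
    fun ν h1 h2 => huniq ν ⟨h1, h2⟩
  -- On the dense orbit of `T a` the function takes values in the closed set `K`, hence everywhere.
  -- So the coding map `π` lands in the full shift over `K`.
  have hfK : ∀ ξ, f ξ ∈ K := by
    have hcl : IsClosed (f ⁻¹' (K : Set ℂ)) := K.finite_toSet.isClosed.preimage hf
    have hsub : Set.range (fun n : ℕ => T^[n] (T a)) ⊆ f ⁻¹' (K : Set ℂ) := by
      rintro _ ⟨n, rfl⟩
      have := (y n).2
      rw [hfy n, Function.iterate_succ_apply] at this
      exact this
    intro ξ
    exact closure_minimal hsub hcl (hmin (T a) ξ)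
  let π : X → ℕ → K := fun ξ n => ⟨f (T^[n] ξ), hfK _⟩
  have hπ : Continuous π := continuous_pi fun n =>
    Continuous.subtype_mk (hf.comp (hT.iterate n)) _
  have hsemi : Function.Semiconj π T shift := fun ξ => by
    funext n
    exact Subtype.ext (by simp only [π, shift, Function.iterate_succ_apply])
  have hyπ : y = π (T a) := by
    funext n
    exact Subtype.ext (by simp only [π, hfy n, Function.iterate_succ_apply])
  have hgen : IsGeneric T μ (T a) := IsUniquelyErgodic.isGeneric hT huniq' (T a)
  refine ⟨μ.map π, Measure.isProbabilityMeasure_map hπ.aemeasurable, ?_, ?_⟩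
  · exact (hπ.measurable.measurePreserving μ).ergodic_of_ergodic_semiconj
      (ergodic_of_unique hμT huniq') continuous_shift.measurable hsemi
  · intro F hF
    rw [integral_map hπ.aemeasurable hF.aestronglyMeasurable, hyπ]
    refine (hgen (fun ξ => F (π ξ)) (hF.comp hπ)).congr fun n => ?_
    congr 1
    exact Finset.sum_congr rfl fun i _ => by rw [(hsemi.iterate_right (i + 1)) (T a)]

/-! ### Stability of correlations -/

lemma norm_average_le {u : ℕ → ℂ} {C : ℝ} (hu : ∀ i, ‖u i‖ ≤ C) (n : ℕ) (hC : 0 ≤ C) :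
    ‖(1 / (n : ℂ)) * ∑ i ∈ range n, u i‖ ≤ C := by
  rcases Nat.eq_zero_or_pos n with rfl | hn
  · simpa using hC
  have hn0 : (0 : ℝ) < n := by exact_mod_cast hn
  rw [norm_mul, norm_div, norm_one, Complex.norm_natCast, one_div, inv_mul_le_iff₀ hn0]
  refine (norm_sum_le _ _).trans ((Finset.sum_le_sum fun i _ => hu i).trans ?_)
  simp

lemma norm_corr_le {x y : ℕ → ℂ} (hx : ∀ i, ‖x i‖ ≤ 1) (hy : ∀ i, ‖y i‖ ≤ 1) (n : ℕ) :
    ‖corr x y n‖ ≤ 2 := by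
  have hy' : ∀ i, ‖(starRingEnd ℂ) (y i)‖ ≤ 1 := fun i => by rw [RCLike.norm_conj]; exact hy i
  have h1 := norm_average_le (u := fun i => x i * (starRingEnd ℂ) (y i)) (C := 1) (fun i => by
    rw [norm_mul]; exact mul_le_one₀ (hx i) (norm_nonneg _) (hy' i)) n zero_le_one
  have h2 := norm_average_le hx n zero_le_one
  have h3 := norm_average_le hy' n zero_le_one
  refine (norm_sub_le _ _).trans ?_
  rw [norm_mul (_ * _) (_ * _)]
  have := mul_le_one₀ h2 (norm_nonneg _) h3
  linarith

lemma corr_sub_right (x y z : ℕ → ℂ) (n : ℕ) :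
    corr x y n - corr x z n = corr x (fun i => y i - z i) n := by
  simp only [corr, map_sub, mul_sub, Finset.sum_sub_distrib]
  ring

lemma norm_corr_le_average {x u : ℕ → ℂ} (hx : ∀ i, ‖x i‖ ≤ 1) {n : ℕ} {δ : ℝ} (hδ : 0 ≤ δ)
    (hu : ∑ i ∈ range n, ‖u i‖ ≤ δ * n) : ‖corr x u n‖ ≤ 2 * δ := by
  rcases Nat.eq_zero_or_pos n with rfl | hn
  · simpa [corr] using hδ
  have hn0 : (0 : ℝ) < n := by exact_mod_cast hn
  have key : ∀ w : ℕ → ℂ, (∀ i, ‖w i‖ ≤ ‖u i‖) →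
      ‖(1 / (n : ℂ)) * ∑ i ∈ range n, w i‖ ≤ δ := by
    intro w hw
    rw [norm_mul, norm_div, norm_one, Complex.norm_natCast, one_div, inv_mul_le_iff₀ hn0,
      mul_comm]
    exact (norm_sum_le _ _).trans ((Finset.sum_le_sum fun i _ => hw i).trans hu)
  have h1 := key (fun i => x i * (starRingEnd ℂ) (u i)) fun i => by
    rw [norm_mul, RCLike.norm_conj]
    exact mul_le_of_le_one_left (norm_nonneg _) (hx i)
  have h2 := norm_average_le hx n zero_le_one
  have h3 := key (fun i => (starRingEnd ℂ) (u i)) fun i => by rw [RCLike.norm_conj]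
  refine (norm_sub_le _ _).trans ?_
  rw [norm_mul (_ * _) (_ * _)]
  have := mul_le_mul h2 h3 (norm_nonneg _) zero_le_one
  linarith

/-- Changing a sequence on a set of small density changes its correlations by a small amount. -/
lemma norm_corr_le_add {K : Finset ℂ} (hK : ∀ z ∈ K, ‖z‖ ≤ 1) (x : ℕ → K) {y z : ℕ → K} {ε : ℝ}
    (hε : 0 ≤ ε) {n : ℕ} (h : ∑ i ∈ range n, ind (y i ≠ z i) ≤ ε * n) :
    ‖corr (fun i => (x i : ℂ)) (fun i => (y i : ℂ)) n‖
      ≤ ‖corr (fun i => (x i : ℂ)) (fun i => (z i : ℂ)) n‖ + 4 * ε := by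
  -- Points of the unit disc are at distance at most `2`, and the difference enters both terms of
  -- the correlation; hence the constant `4`.
  have hd : ∀ i, ‖(y i : ℂ) - z i‖ ≤ 2 * ind (y i ≠ z i) := by
    intro i
    by_cases hi : y i = z i
    · rw [hi, sub_self, norm_zero]
      exact mul_nonneg zero_le_two (ind_nonneg _)
    · rw [ind_of hi]
      have := norm_sub_le (y i : ℂ) (z i)
      linarith [hK _ (y i).2, hK _ (z i).2]
  have h2 := norm_corr_le_average (x := fun i => (x i : ℂ)) (u := fun i => (y i : ℂ) - z i)
    (n := n) (δ := 2 * ε) (fun i => hK _ (x i).2) (by linarith) (by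
      refine (Finset.sum_le_sum fun i _ => hd i).trans ?_
      rw [← Finset.mul_sum]; linarith)
  rw [← corr_sub_right] at h2
  have := norm_sub_norm_le (corr (fun i => (x i : ℂ)) (fun i => (y i : ℂ)) n)
    (corr (fun i => (x i : ℂ)) (fun i => (z i : ℂ)) n)
  linarith

lemma exists_eventually_of_pos_liminf {u : ℕ → ℝ} (hb : ∀ n, 0 ≤ u n) (h : 0 < liminf u atTop) :
    ∃ c > 0, ∀ᶠ n in atTop, c ≤ u n :=
  ⟨_, half_pos h, (eventually_lt_of_lt_liminf (half_lt_self h)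
    (isBoundedUnder_of ⟨0, hb⟩)).mono fun _ hn => hn.le⟩

lemma exists_frequently_of_pos_limsup {u : ℕ → ℝ} (hb : ∀ n, 0 ≤ u n) (h : 0 < limsup u atTop) :
    ∃ c > 0, ∃ᶠ n in atTop, c ≤ u n :=
  ⟨_, half_pos h, (frequently_lt_of_lt_limsup
    (isBoundedUnder_of ⟨0, hb⟩ : IsBoundedUnder (· ≥ ·) atTop u).isCoboundedUnder_le
    (half_lt_self h)).mono fun _ hn => hn.le⟩

/-- A point which is generic for an ergodic measure can be approximated in density by strictly
ergodic points. -/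
theorem IsGenericForErgodic.exists_isStrictlyErgodicSeq {K : Finset ℂ} {y : ℕ → K}
    (hy : IsGenericForErgodic y) {ε : ℝ} (hε : 0 < ε) :
    ∃ z : ℕ → K, IsStrictlyErgodicSeq (fun n => (z n : ℂ)) ∧
      ∀ n, ∑ i ∈ range n, ind (y i ≠ z i) ≤ ε * n := by
  obtain ⟨ν, _, hν, hyν⟩ := hy
  obtain ⟨z, hf, hr, hz⟩ := (hyν.ergSeq hν).exists_uniform hε
  exact ⟨z, isStrictlyErgodicSeq_of_uniform hf hr fun k => (k : ℂ), hz⟩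

/-- Approximation up to density `c / 8` costs at most `c / 2`, so correlations that are at least `c`
infinitely often remain at least `c / 2` at the same times. -/
theorem IsGenericForErgodic.exists_weaklyCorrelated {K : Finset ℂ} (hK : ∀ z ∈ K, ‖z‖ ≤ 1)
    {x y : ℕ → K} (hy : IsGenericForErgodic y)
    (h : WeaklyCorrelated (fun n => (x n : ℂ)) (fun n => (y n : ℂ))) :
    ∃ z : ℕ → K, IsStrictlyErgodicSeq (fun n => (z n : ℂ)) ∧
      WeaklyCorrelated (fun n => (x n : ℂ)) (fun n => (z n : ℂ)) := by
  obtain ⟨c, hc, hfr⟩ := exists_frequently_of_pos_limsup (fun n => norm_nonneg _) h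
  obtain ⟨z, hz, hyz⟩ := hy.exists_isStrictlyErgodicSeq (div_pos hc (show (0 : ℝ) < 8 by norm_num))
  refine ⟨z, hz, (half_pos hc).trans_le (le_limsup_of_frequently_le (hfr.mono fun n hn => ?_) ?_)⟩
  · have := norm_corr_le_add hK x (div_pos hc (show (0 : ℝ) < 8 by norm_num)).le (hyz n)
    linarith
  · exact isBoundedUnder_of ⟨2, norm_corr_le (fun i => hK _ (x i).2) fun i => hK _ (z i).2⟩

theorem IsGenericForErgodic.exists_stronglyCorrelated {K : Finset ℂ} (hK : ∀ z ∈ K, ‖z‖ ≤ 1)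
    {x y : ℕ → K} (hy : IsGenericForErgodic y)
    (h : StronglyCorrelated (fun n => (x n : ℂ)) (fun n => (y n : ℂ))) :
    ∃ z : ℕ → K, IsStrictlyErgodicSeq (fun n => (z n : ℂ)) ∧
      StronglyCorrelated (fun n => (x n : ℂ)) (fun n => (z n : ℂ)) := by
  obtain ⟨c, hc, hev⟩ := exists_eventually_of_pos_liminf (fun n => norm_nonneg _) h
  obtain ⟨z, hz, hyz⟩ := hy.exists_isStrictlyErgodicSeq (div_pos hc (show (0 : ℝ) < 8 by norm_num))
  refine ⟨z, hz, (half_pos hc).trans_le (le_liminf_of_le ?_ (hev.mono fun n hn => ?_))⟩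
  · exact (isBoundedUnder_of ⟨2, norm_corr_le (fun i => hK _ (x i).2) fun i => hK _ (z i).2⟩ :
      IsBoundedUnder (· ≤ ·) atTop _).isCoboundedUnder_ge
  · have := norm_corr_le_add hK x (div_pos hc (show (0 : ℝ) < 8 by norm_num)).le (hyz n)
    linarith

end SeqCorr

theorem theorem1p2 (K : Finset ℂ) (hK : ∀ z ∈ K, ‖z‖ ≤ 1) (x : ℕ → K) :
    ((∃ y : ℕ → K, SeqCorr.IsStrictlyErgodicSeq (fun n => (y n : ℂ)) ∧
        SeqCorr.WeaklyCorrelated (fun n => (x n : ℂ)) (fun n => (y n : ℂ))) ↔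
      (∃ y : ℕ → K, SeqCorr.IsGenericForErgodic y ∧
        SeqCorr.WeaklyCorrelated (fun n => (x n : ℂ)) (fun n => (y n : ℂ)))) ∧
    ((∃ y : ℕ → K, SeqCorr.IsStrictlyErgodicSeq (fun n => (y n : ℂ)) ∧
        SeqCorr.StronglyCorrelated (fun n => (x n : ℂ)) (fun n => (y n : ℂ))) ↔
      (∃ y : ℕ → K, SeqCorr.IsGenericForErgodic y ∧
        SeqCorr.StronglyCorrelated (fun n => (x n : ℂ)) (fun n => (y n : ℂ)))) :=
  ⟨⟨fun ⟨y, hy, h⟩ => ⟨y, hy.isGenericForErgodic, h⟩,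
      fun ⟨_, hy, h⟩ => hy.exists_weaklyCorrelated hK h⟩,
    ⟨fun ⟨y, hy, h⟩ => ⟨y, hy.isGenericForErgodic, h⟩,
      fun ⟨_, hy, h⟩ => hy.exists_stronglyCorrelated hK h⟩⟩
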